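/- Let $f(t)=\sum_{k=0}^\infty a_k t^k$, where $a_0,a_1,\dots$ are i.i.d. real standard Gaussian random variables, and consider the real zeros of $f$ in $(-1,1)$. For a Borel set $D\subseteq(-1,1)$ let $N(D)$ be the number of real zeros of $f$ in $D$. For $n\ge 1$, the $n$-point correlation function of the real zeros is the continuous function $\rho_n:(-1,1)^n\to[0,\infty)$ such that $$E\Big[\prod_{i=1}^n N(D_i)\Big]=\int_{D_1\times\cdots\times D_n}\rho_n(t_1,\dots,t_n)\,dt_1\cdots dt_n$$ for all mutually disjoint Borel sets $D_1,\dots,D_n\subseteq(-1,1)$. Then $\rho_1$ and $\rho_2$ exist, $\rho_1>0$ on $(-1,1)$, and the normalized $2$-point correlation function $$R(s,t)=\frac{\rho_2(s,t)}{\rho_1(s)\rho_1(t)},\qquad s,t\in(-1,1),$$ has the following properties. For every $s\in(-1,1)$ the function $t\mapsto R(s,t)$ extends to a continuous function on $[-1,1]$, again denoted by $R(s,\cdot)$, and $$R(s,s)=0,\qquad R(s,1)=R(s,-1)=1;$$ moreover $t\mapsto R(s,t)$ is strictly increasing on $[s,1]$ and strictly decreasing on $[-1,s]$. In particular, $$\rho_2(s,t)\le\rho_1(s)\,\rho_1(t)\qquad\text{for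 all } s,t\in(-1,1),$$ that is, the real zeros of $f$ are negatively correlated. -/

import Mathlib

open MeasureTheory ProbabilityTheory Set
open scoped ENNReal

namespace GaussianPowerSeries

/-- The coefficients are i.i.d. real standard Gaussian random variables. -/
structure IsIIDStandardGaussian {Ω : Type*} [MeasurableSpace Ω] (P : Measure Ω)
    (a : ℕ → Ω → ℝ) : Prop where
  hasLaw : ∀ k, HasLaw (a k) (gaussianReal 0 1) P
  indep : iIndepFun a P

/-- The set of real zeros in `(-1, 1)` of the power series `f(t) = ∑ k, a k ω * t ^ k`:
the points at which the series converges with sum `0`. -/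
def realZeros {Ω : Type*} (a : ℕ → Ω → ℝ) (ω : Ω) : Set ℝ :=
  {t | t ∈ Ioo (-1 : ℝ) 1 ∧ HasSum (fun k : ℕ => a k ω * t ^ k) 0}

/-- `ρ` is the (continuous version of the) `n`-point correlation function, with respect to
Lebesgue measure, of a random set `Z` of points of `(-1, 1)`: a nonnegative continuous function
on `(-1, 1)ⁿ` such that, for all mutually disjoint Borel sets `D 0, …, D (n - 1) ⊆ (-1, 1)`,
the expectation of the product of the numbers of points of `Z` in the sets `D i` is the integral
of `ρ` over the product of the sets `D i`. Continuity singles out one version of the density, so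
that values at individual points (also on the diagonal) are meaningful. -/
structure IsCorrelationFunction {Ω : Type*} [MeasurableSpace Ω] (P : Measure Ω)
    (Z : Ω → Set ℝ) (n : ℕ) (ρ : (Fin n → ℝ) → ℝ) : Prop where
  continuousOn : ContinuousOn ρ (Set.pi univ fun _ => Ioo (-1 : ℝ) 1)
  nonneg : ∀ t ∈ Set.pi univ (fun _ : Fin n => Ioo (-1 : ℝ) 1), 0 ≤ ρ t
  lintegral_prod_count : ∀ D : Fin n → Set ℝ, (∀ i, MeasurableSet (D i)) →
    (∀ i, D i ⊆ Ioo (-1 : ℝ) 1) → (∀ i j, i ≠ j → Disjoint (D i) (D j)) →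
    ∫⁻ ω, ∏ i, (((Z ω ∩ D i).encard : ℕ∞) : ℝ≥0∞) ∂P
      = ∫⁻ t in Set.pi univ D, ENNReal.ofReal (ρ t)

/-- The normalized 2-point correlation function `ρ₂(s, t) / (ρ₁(s) ρ₁(t))`. -/
noncomputable def normalizedCorrelation (ρ₁ : (Fin 1 → ℝ) → ℝ) (ρ₂ : (Fin 2 → ℝ) → ℝ)
    (s t : ℝ) : ℝ :=
  ρ₂ ![s, t] / (ρ₁ ![s] * ρ₁ ![t])

end GaussianPowerSeries

namespace GaussianPowerSeries

open Filter Topology Function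
open scoped NNReal

section AreaFormula

theorem encard_iUnion_eq_tsum {α : Type*} {s : ℕ → Set α} (h : Pairwise (Disjoint on s)) :
    (((⋃ n, s n).encard : ℕ∞) : ℝ≥0∞) = ∑' n, ((s n).encard : ℝ≥0∞) := by
  let m : MeasurableSpace α := ⊤
  have hm : ∀ t : Set α, MeasurableSet t := fun _ => MeasurableSpace.measurableSet_top
  simp_rw [← Measure.count_apply (hm _)]
  exact measure_iUnion h fun _ => hm _

/-- The change of variables formula for maps that need not be injective: fibres are counted with
multiplicity. -/
theorem lintegral_encard_fiber_mul {E : Type*} [NormedAddCommGroup E] [NormedSpace ℝ E]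
    [FiniteDimensional ℝ E] [MeasurableSpace E] [BorelSpace E] (ν : Measure E)
    [ν.IsAddHaarMeasure] {s : Set E} {f : E → E} {f' : E → E →L[ℝ] E} (hs : MeasurableSet s)
    (hf : ∀ x ∈ s, HasFDerivAt f (f' x) x) (hdet : MeasurableSet {x ∈ s | (f' x).det = 0})
    {g : E → ℝ≥0∞} (hg : Measurable g) :
    ∫⁻ y, ((s ∩ f ⁻¹' {y}).encard : ℝ≥0∞) * g y ∂ν
      = ∫⁻ x in s, ENNReal.ofReal |(f' x).det| * g (f x) ∂ν := by
  set s₀ : Set E := {x ∈ s | (f' x).det = 0} with hs₀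
  set s₁ : Set E := s \ s₀ with hs₁
  have hs₁m : MeasurableSet s₁ := hs.diff hdet
  have hdet₁ : ∀ x ∈ s₁, (f' x).det ≠ 0 := fun x hx h => hx.2 ⟨hx.1, h⟩
  have hinv : ∀ A : E →L[ℝ] E, A.det ≠ 0 → ∃ e : E ≃L[ℝ] E, (e : E →L[ℝ] E) = A := fun A hA =>
    ⟨A.toContinuousLinearEquivOfDetNeZero hA, A.coe_toContinuousLinearEquivOfDetNeZero hA⟩
  have hr : ∀ A : E →L[ℝ] E, ∃ r : ℝ≥0, r ≠ 0 ∧ (A.det ≠ 0 →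
      ∀ u : Set E, ApproximatesLinearOn f A u r → InjOn f u) := by
    intro A
    by_cases hA : A.det = 0
    · exact ⟨1, one_ne_zero, fun h => absurd hA h⟩
    obtain ⟨e, rfl⟩ := hinv A hA
    rcases subsingleton_or_nontrivial E with h | h
    · exact ⟨1, one_ne_zero, fun _ u _ x _ y _ _ => Subsingleton.elim x y⟩
    have hpos : (0 : ℝ≥0) < ‖(e.symm : E →L[ℝ] E)‖₊⁻¹ :=
      inv_pos.2 e.nnnorm_symm_pos
    obtain ⟨r, hr0, hr1⟩ := exists_between hpos
    exact ⟨r, hr0.ne', fun _ u hu => hu.injOn (Or.inr hr1)⟩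
  choose r hr0 hrinj using hr
  obtain ⟨t, A, htd, htm, hts, htA, hA⟩ :=
    exists_partition_approximatesLinearOn_of_hasFDerivWithinAt f s₁ f'
      (fun x hx => (hf x hx.1).hasFDerivWithinAt) r hr0
  have hinj : ∀ n, InjOn f (s₁ ∩ t n) := by
    intro n
    rcases s₁.eq_empty_or_nonempty with h | h
    · simp [h]
    obtain ⟨y, hy, hAy⟩ := hA h n
    exact hrinj (A n) (hAy ▸ hdet₁ y hy) _ (htA n)
  have hpm : ∀ n, MeasurableSet (s₁ ∩ t n) := fun n => hs₁m.inter (htm n)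
  have hpd : Pairwise (Disjoint on fun n => s₁ ∩ t n) := fun i j hij =>
    (htd hij).mono inter_subset_right inter_subset_right
  have hpu : (⋃ n, s₁ ∩ t n) = s₁ := by
    rw [← inter_iUnion]; exact inter_eq_left.2 hts
  have hder : ∀ n, ∀ x ∈ s₁ ∩ t n, HasFDerivWithinAt f (f' x) (s₁ ∩ t n) x := fun n x hx =>
    (hf x hx.1.1).hasFDerivWithinAt
  have himg : ∀ n, MeasurableSet (f '' (s₁ ∩ t n)) := fun n =>
    measurable_image_of_fderivWithin (hpm n) (hder n) (hinj n)
  have hnull : ν (f '' s₀) = 0 := addHaar_image_eq_zero_of_det_fderivWithin_eq_zero ν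
    (fun x hx => (hf x hx.1).hasFDerivWithinAt) fun x hx => hx.2
  have hcount : ∀ᵐ y ∂ν, ((s ∩ f ⁻¹' {y}).encard : ℝ≥0∞) * g y
      = ∑' n, (f '' (s₁ ∩ t n)).indicator g y := by
    have : ∀ᵐ y ∂ν, y ∉ f '' s₀ := measure_eq_zero_iff_ae_notMem.1 hnull
    filter_upwards [this] with y hy
    have h1 : s ∩ f ⁻¹' {y} = ⋃ n, (s₁ ∩ t n) ∩ f ⁻¹' {y} := by
      rw [← iUnion_inter, hpu]
      ext x
      simp only [mem_inter_iff, mem_preimage, mem_singleton_iff, hs₁, Set.mem_sdiff]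
      exact ⟨fun h => ⟨⟨h.1, fun h0 => hy ⟨x, h0, h.2⟩⟩, h.2⟩, fun h => ⟨h.1.1, h.2⟩⟩
    rw [h1, encard_iUnion_eq_tsum fun i j hij =>
      (hpd hij).mono inter_subset_left inter_subset_left, ← ENNReal.tsum_mul_right]
    congr 1 with n
    by_cases hyn : y ∈ f '' (s₁ ∩ t n)
    · obtain ⟨x, hx, rfl⟩ := hyn
      have : s₁ ∩ t n ∩ f ⁻¹' {f x} = {x} := by
        ext z
        simp only [mem_inter_iff, mem_preimage, mem_singleton_iff]
        exact ⟨fun h => hinj n h.1 hx h.2, by rintro rfl; exact ⟨hx, rfl⟩⟩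
      rw [this, indicator_of_mem (mem_image_of_mem f hx)]
      simp
    · have : s₁ ∩ t n ∩ f ⁻¹' {y} = ∅ := by
        ext z
        simp only [mem_inter_iff, mem_preimage, mem_singleton_iff, mem_empty_iff_false, iff_false]
        exact fun h => hyn ⟨z, h.1, h.2⟩
      rw [this, indicator_of_notMem hyn]
      simp
  have hsplit : ∫⁻ x in s, ENNReal.ofReal |(f' x).det| * g (f x) ∂ν
      = ∫⁻ x in s₁, ENNReal.ofReal |(f' x).det| * g (f x) ∂ν := by
    rw [← lintegral_inter_add_sdiff _ s hdet, ← hs₁,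
      setLIntegral_eq_zero (hs.inter hdet), zero_add]
    intro x hx
    simp [hx.2.2]
  rw [lintegral_congr_ae hcount, lintegral_tsum fun n => (hg.indicator (himg n)).aemeasurable,
    hsplit]
  conv_rhs => rw [← hpu]
  rw [lintegral_iUnion hpm hpd]
  congr 1 with n
  rw [lintegral_indicator (himg n),
    lintegral_image_eq_lintegral_abs_det_fderiv_mul ν (hpm n) (hder n) (hinj n)]

end AreaFormula

section PowerSeries

/-- Polynomially bounded real sequences. -/
def PolyGrowth (c : ℕ → ℝ) : Prop := ∃ N : ℕ, ∀ k : ℕ, |c k| ≤ N * (k + 1 : ℝ) ^ N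

/-- The sum of the power series with coefficients `c`. -/
noncomputable def seriesSum (c : ℕ → ℝ) (t : ℝ) : ℝ := ∑' k, c k * t ^ k

/-- The coefficients of the derivative of a power series. -/
def derivCoeff (c : ℕ → ℝ) (k : ℕ) : ℝ := (k + 1) * c (k + 1)

theorem PolyGrowth.of_le {c : ℕ → ℝ} {C : ℝ} {m : ℕ} (h : ∀ k : ℕ, |c k| ≤ C * (k + 1 : ℝ) ^ m) :
    PolyGrowth c := by
  refine ⟨⌈C⌉₊ + m, fun k => (h k).trans ?_⟩
  have h1 : (1 : ℝ) ≤ k + 1 := by linarith [k.cast_nonneg (α := ℝ)]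
  have h2 : C ≤ ((⌈C⌉₊ + m : ℕ) : ℝ) := by
    push_cast
    linarith [Nat.le_ceil C, m.cast_nonneg (α := ℝ)]
  exact mul_le_mul h2 (pow_le_pow_right₀ h1 (by omega)) (by positivity) (by positivity)

theorem PolyGrowth.derivCoeff {c : ℕ → ℝ} (hc : PolyGrowth c) : PolyGrowth (derivCoeff c) := by
  obtain ⟨N, hN⟩ := hc
  refine PolyGrowth.of_le (C := N * 2 ^ N) (m := N + 1) fun k => ?_
  have h0 : (0 : ℝ) ≤ k := k.cast_nonneg
  have h1 := hN (k + 1)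
  push_cast at h1
  rw [GaussianPowerSeries.derivCoeff, abs_mul, abs_of_nonneg (by linarith : (0 : ℝ) ≤ k + 1)]
  calc (k + 1 : ℝ) * |c (k + 1)| ≤ (k + 1) * (N * (2 * (k + 1)) ^ N) := by
        refine mul_le_mul_of_nonneg_left (h1.trans ?_) (by linarith)
        gcongr
        linarith
    _ = N * 2 ^ N * (k + 1 : ℝ) ^ (N + 1) := by rw [mul_pow]; ring

theorem PolyGrowth.cons {c : ℕ → ℝ} (hc : PolyGrowth c) (x : ℝ) :
    PolyGrowth (fun k => Nat.casesOn k x c) := by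
  obtain ⟨N, hN⟩ := hc
  refine PolyGrowth.of_le (C := |x| + N) (m := N) fun k => ?_
  cases k with
  | zero => simp
  | succ k =>
    refine (hN k).trans ?_
    push_cast
    have h0 : (0 : ℝ) ≤ k := k.cast_nonneg
    gcongr <;> linarith [abs_nonneg x]

theorem PolyGrowth.summable_abs {c : ℕ → ℝ} (hc : PolyGrowth c) {t : ℝ} (ht : |t| < 1) :
    Summable fun k => |c k| * |t| ^ k := by
  obtain ⟨N, hN⟩ := hc
  have hs : Summable fun k : ℕ => N * 2 ^ N * ((k : ℝ) ^ N * |t| ^ k + |t| ^ k) := by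
    have ht' : ‖|t|‖ < 1 := by simpa using ht
    exact ((summable_pow_mul_geometric_of_norm_lt_one N ht').add
      (summable_geometric_of_norm_lt_one ht')).mul_left _
  refine Summable.of_nonneg_of_le (fun k => by positivity) (fun k => ?_) hs
  have h1 : (k + 1 : ℝ) ^ N ≤ 2 ^ N * ((k : ℝ) ^ N + 1) := by
    rcases Nat.eq_zero_or_pos k with rfl | hk
    · simp only [CharP.cast_eq_zero, zero_add, one_pow]
      have : (1 : ℝ) ≤ 2 ^ N := one_le_pow₀ (by norm_num)
      have h0 : (0 : ℝ) ≤ 0 ^ N := by positivity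
      nlinarith
    · have hk' : (1 : ℝ) ≤ k := by exact_mod_cast hk
      calc (k + 1 : ℝ) ^ N ≤ (2 * k) ^ N := by gcongr; linarith
        _ = 2 ^ N * (k : ℝ) ^ N := mul_pow _ _ _
        _ ≤ _ := by gcongr; linarith
  calc |c k| * |t| ^ k ≤ (N * (k + 1 : ℝ) ^ N) * |t| ^ k := by gcongr; exact hN k
    _ ≤ (N * (2 ^ N * ((k : ℝ) ^ N + 1))) * |t| ^ k := by gcongr
    _ = _ := by ring

theorem PolyGrowth.summable {c : ℕ → ℝ} (hc : PolyGrowth c) {t : ℝ} (ht : |t| < 1) :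
    Summable fun k => c k * t ^ k :=
  Summable.of_norm (by simpa [abs_mul] using hc.summable_abs ht)

theorem PolyGrowth.hasSum {c : ℕ → ℝ} (hc : PolyGrowth c) {t : ℝ} (ht : |t| < 1) :
    HasSum (fun k => c k * t ^ k) (seriesSum c t) := (hc.summable ht).hasSum

theorem PolyGrowth.hasDerivAt {c : ℕ → ℝ} (hc : PolyGrowth c) {t : ℝ} (ht : |t| < 1) :
    HasDerivAt (seriesSum c) (seriesSum (GaussianPowerSeries.derivCoeff c) t) t := by
  obtain ⟨r, hr1, hr2⟩ := exists_between ht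
  have hr0 : 0 ≤ r := (abs_nonneg t).trans hr1.le
  have hu : Summable fun n : ℕ => |c n| * (n * r ^ (n - 1)) := by
    rw [← summable_nat_add_iff 1]
    refine (hc.derivCoeff.summable_abs (t := r) (by rwa [abs_of_nonneg hr0])).congr fun n => ?_
    rw [GaussianPowerSeries.derivCoeff, abs_mul, abs_of_nonneg hr0,
      abs_of_nonneg (by positivity : (0 : ℝ) ≤ n + 1)]
    push_cast
    ring
  have hmem : t ∈ Ioo (-r) r := abs_lt.1 hr1
  have key := hasDerivAt_tsum_of_isPreconnected (g := fun n y => c n * y ^ n)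
    (g' := fun n y => c n * (n * y ^ (n - 1))) (y₀ := t) (y := t) hu isOpen_Ioo isPreconnected_Ioo
    (fun n y _ => (hasDerivAt_pow n y).const_mul (c n))
    (fun n y hy => by
      rw [norm_mul, norm_mul, norm_pow, Real.norm_eq_abs, Real.norm_eq_abs, Real.norm_eq_abs,
        Nat.abs_cast]
      gcongr
      exact (abs_lt.2 hy).le) hmem (hc.summable ht) hmem
  suffices h : seriesSum (GaussianPowerSeries.derivCoeff c) t
      = ∑' n : ℕ, c n * (n * t ^ (n - 1)) by rw [h]; exact key
  have hsum : Summable fun n : ℕ => c n * (n * t ^ (n - 1)) := by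
    refine Summable.of_norm_bounded hu fun n => ?_
    rw [norm_mul, norm_mul, norm_pow, Real.norm_eq_abs, Real.norm_eq_abs, Real.norm_eq_abs,
        Nat.abs_cast]
    gcongr
  rw [hsum.tsum_eq_zero_add, seriesSum]
  simp only [CharP.cast_eq_zero, zero_mul, mul_zero, zero_add, Nat.add_sub_cancel]
  refine tsum_congr fun n => ?_
  rw [GaussianPowerSeries.derivCoeff]
  push_cast
  ring

theorem PolyGrowth.continuousOn {c : ℕ → ℝ} (hc : PolyGrowth c) :
    ContinuousOn (seriesSum c) (Ioo (-1) 1) := fun _ ht =>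
  (hc.hasDerivAt (abs_lt.2 ht)).continuousAt.continuousWithinAt

theorem PolyGrowth.analyticOnNhd {c : ℕ → ℝ} (hc : PolyGrowth c) :
    AnalyticOnNhd ℝ (seriesSum c) (Ioo (-1) 1) := by
  set p := FormalMultilinearSeries.ofScalars ℝ c
  have hrad : 1 ≤ p.radius := by
    refine le_of_forall_lt_imp_le_of_dense fun r hr => ?_
    lift r to ℝ≥0 using hr.ne_top
    refine p.le_radius_of_summable ?_
    have h1 : |(r : ℝ)| < 1 := by
      rw [NNReal.abs_eq]; exact_mod_cast hr
    refine (hc.summable_abs h1).congr fun n => ?_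
    rw [FormalMultilinearSeries.ofScalars_norm, NNReal.abs_eq, Real.norm_eq_abs]
  have hsum : p.sum = seriesSum c := by
    ext t
    simp [p, seriesSum, FormalMultilinearSeries.sum, mul_comm]
  have h := (p.hasFPowerSeriesOnBall (zero_lt_one.trans_le hrad)).analyticOnNhd
  rw [hsum] at h
  refine h.mono fun t ht => ?_
  rw [Metric.mem_eball, edist_dist, Real.dist_eq, sub_zero]
  refine lt_of_lt_of_le ?_ hrad
  rw [← ENNReal.ofReal_one]
  exact (ENNReal.ofReal_lt_ofReal_iff one_pos).2 (abs_lt.2 ht)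

theorem seriesSum_zero (c : ℕ → ℝ) : seriesSum c 0 = c 0 := by
  rw [seriesSum, tsum_eq_single 0 fun k hk => by simp [hk]]
  simp

theorem PolyGrowth.finite_zeros {c : ℕ → ℝ} (hc : PolyGrowth c) (h0 : c 0 ≠ 0) {K : Set ℝ}
    (hK : IsCompact K) (hKI : K ⊆ Ioo (-1) 1) : {t ∈ K | seriesSum c t = 0}.Finite := by
  by_contra hinf
  obtain ⟨z, hz, hacc⟩ :=
    Set.Infinite.exists_accPt_of_subset_isCompact hinf hK (sep_subset _ _)
  rw [accPt_iff_frequently_nhdsNE] at hacc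
  have := hc.analyticOnNhd.eqOn_zero_of_preconnected_of_frequently_eq_zero isPreconnected_Ioo
    (hKI hz) (hacc.mono fun x hx => hx.2)
  have h1 := this (show (0 : ℝ) ∈ Ioo (-1) 1 by norm_num)
  rw [seriesSum_zero] at h1
  exact h0 h1

theorem PolyGrowth.seriesSum_cons {c : ℕ → ℝ} (hc : PolyGrowth c) (x : ℝ) {t : ℝ}
    (ht : |t| < 1) : seriesSum (fun k => Nat.casesOn k x c) t = x + t * seriesSum c t := by
  rw [seriesSum, ((hc.cons x).summable ht).tsum_eq_zero_add, seriesSum, ← tsum_mul_left]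
  simp only [pow_zero, mul_one]
  congr 1
  exact tsum_congr fun k => by ring

theorem measurable_tsum_real {X : Type*} [MeasurableSpace X] {f : ℕ → X → ℝ}
    (hf : ∀ k, Measurable (f k)) : Measurable fun x => ∑' k, f k x := by
  have hS : MeasurableSet {x | Summable fun k => f k x} := by
    have : {x | Summable fun k => f k x} = {x | ∑' k, ‖f k x‖ₑ < ∞} := by
      ext x
      rw [Set.mem_ofPred_eq, Set.mem_ofPred_eq, ← summable_norm_iff, lt_top_iff_ne_top]
      exact (tsum_enorm_ne_top_iff_summable_norm (f := fun k => f k x)).symm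
    rw [this]
    exact measurableSet_lt (Measurable.tsum fun k => (hf k).enorm) measurable_const
  refine measurable_of_tendsto_metrizable
    (f := fun n => {x | Summable fun k => f k x}.indicator fun x => ∑ k ∈ Finset.range n, f k x)
    (fun n => (Finset.measurable_fun_sum _ fun k _ => hf k).indicator hS)
    (tendsto_pi_nhds.2 fun x => ?_)
  by_cases hx : Summable fun k => f k x
  · simpa [indicator, hx] using hx.hasSum.tendsto_sum_nat
  · simp [indicator, hx, tsum_eq_zero_of_not_summable hx]

theorem measurable_seriesSum : Measurable fun p : (ℕ → ℝ) × ℝ => seriesSum p.1 p.2 :=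
  measurable_tsum_real fun k => by fun_prop

theorem measurable_derivCoeff : Measurable derivCoeff :=
  measurable_pi_lambda _ fun k => by unfold derivCoeff; fun_prop

theorem measurableSet_polyGrowth : MeasurableSet {c : ℕ → ℝ | PolyGrowth c} := by
  simp only [PolyGrowth, Set.ofPred_exists, Set.ofPred_forall]
  exact .iUnion fun N => .iInter fun k => measurableSet_le (by fun_prop) (by fun_prop)

end PowerSeries

section ZeroCounting

theorem measurableSet_exists_zero {K : Set ℝ} (hK : IsCompact K) (hKI : K ⊆ Ioo (-1) 1) :
    MeasurableSet {c | PolyGrowth c ∧ ∃ t ∈ K, seriesSum c t = 0} := by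
  rcases K.eq_empty_or_nonempty with rfl | hne
  · simp
  have : Nonempty K := hne.to_subtype
  set d := TopologicalSpace.denseSeq K
  have hd : DenseRange d := TopologicalSpace.denseRange_denseSeq K
  have heq : {c | PolyGrowth c ∧ ∃ t ∈ K, seriesSum c t = 0}
      = {c | PolyGrowth c} ∩ ⋂ m : ℕ, ⋃ i, {c | |seriesSum c (d i)| < 1 / (m + 1 : ℝ)} := by
    ext c
    simp only [Set.mem_ofPred_eq, mem_inter_iff, mem_iInter, mem_iUnion]
    refine and_congr_right fun hc => ?_
    have hcont : ContinuousOn (fun t => |seriesSum c t|) K := (hc.continuousOn.mono hKI).abs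
    constructor
    · rintro ⟨t, htK, ht⟩ m
      have hopen : IsOpen {x : K | |seriesSum c x| < 1 / (m + 1 : ℝ)} :=
        isOpen_lt (continuousOn_iff_continuous_domRestrict.1 hcont) continuous_const
      exact hd.exists_mem_open hopen ⟨⟨t, htK⟩, by simp only [Set.mem_ofPred_eq, ht, abs_zero]; positivity⟩
    · intro h
      obtain ⟨t, htK, ht⟩ := hK.exists_isMinOn hne hcont
      refine ⟨t, htK, abs_eq_zero.1 (le_antisymm ?_ (abs_nonneg _))⟩
      refine le_of_forall_pos_lt_add fun ε hε => ?_
      obtain ⟨m, hm⟩ := exists_nat_one_div_lt hε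
      obtain ⟨i, hi⟩ := h m
      rw [zero_add]
      exact ((ht (d i).2).trans_lt hi).trans hm
  rw [heq]
  exact measurableSet_polyGrowth.inter (.iInter fun m => .iUnion fun i => measurableSet_lt
    (measurable_seriesSum.comp (measurable_id.prodMk measurable_const)).abs measurable_const)

theorem encard_eq_iSup_encard_floor {A : Set ℝ} (hA : A.Finite) :
    (A.encard : ℝ≥0∞) = ⨆ n : ℕ, (((fun t : ℝ => ⌊n * t⌋) '' A).encard : ℝ≥0∞) := by
  refine le_antisymm ?_ (iSup_le fun n => by exact_mod_cast encard_image_le _ A)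
  have hev : ∀ᶠ n : ℕ in atTop, ∀ p ∈ A ×ˢ A, p.1 ≠ p.2 → 1 ≤ n * |p.1 - p.2| := by
    rw [eventually_all_finite (hA.prod hA)]
    intro p _
    by_cases hp : p.1 = p.2
    · simp [hp]
    have hpos : 0 < |p.1 - p.2| := abs_pos.2 (sub_ne_zero.2 hp)
    filter_upwards [(tendsto_natCast_atTop_atTop (R := ℝ)).eventually_ge_atTop (1 / |p.1 - p.2|)]
      with n hn _
    rwa [div_le_iff₀ hpos] at hn
  obtain ⟨n, hn⟩ := hev.exists
  refine le_iSup_of_le n ?_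
  have hinj : InjOn (fun t : ℝ => ⌊n * t⌋) A := by
    intro x hx y hy hxy
    by_contra hne
    have h1 := Int.abs_sub_lt_one_of_floor_eq_floor hxy
    rw [← mul_sub, abs_mul, Nat.abs_cast] at h1
    exact absurd (hn (x, y) ⟨hx, hy⟩ hne) (not_le.2 h1)
  rw [hinj.encard_image]

/-- Coefficient sequences for which the zeros of the power series are well behaved. -/
def goodCoeffs : Set (ℕ → ℝ) := {c | PolyGrowth c ∧ c 0 ≠ 0}

theorem measurableSet_goodCoeffs : MeasurableSet goodCoeffs :=
  measurableSet_polyGrowth.inter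
    (measurableSet_eq_fun (measurable_pi_apply 0) measurable_const).compl

theorem measurableSet_exists_zero_floor {a b : ℝ} (hab : Icc a b ⊆ Ioo (-1) 1) (n : ℕ) (j : ℤ) :
    MeasurableSet {c | PolyGrowth c ∧ ∃ t ∈ Icc a b, ⌊n * t⌋ = j ∧ seriesSum c t = 0} := by
  have heq : {c | PolyGrowth c ∧ ∃ t ∈ Icc a b, ⌊n * t⌋ = j ∧ seriesSum c t = 0}
      = ⋃ m : ℕ, {c | PolyGrowth c ∧ ∃ t ∈ Icc a b ∩ {t | (j : ℝ) ≤ n * t}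
          ∩ {t | n * t ≤ j + 1 - 1 / (m + 1 : ℝ)}, seriesSum c t = 0} := by
    ext c
    simp only [Set.mem_ofPred_eq, mem_inter_iff, mem_iUnion, Int.floor_eq_iff]
    constructor
    · rintro ⟨hc, t, ht, ⟨h1, h2⟩, h0⟩
      obtain ⟨m, hm⟩ := exists_nat_one_div_lt (sub_pos.2 h2)
      exact ⟨m, hc, t, ⟨⟨ht, h1⟩, by linarith⟩, h0⟩
    · rintro ⟨m, hc, t, ⟨⟨ht, h1⟩, h2⟩, h0⟩
      have : 0 < 1 / (m + 1 : ℝ) := by positivity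
      exact ⟨hc, t, ht, ⟨h1, by linarith⟩, h0⟩
  rw [heq]
  refine .iUnion fun m => measurableSet_exists_zero ?_ fun t ht => hab ht.1.1
  exact (isCompact_Icc.inter_right (isClosed_le continuous_const (by fun_prop))).inter_right
    (isClosed_le (by fun_prop) continuous_const)

theorem measurable_indicator_encard_zeros_Icc {a b : ℝ} (hab : Icc a b ⊆ Ioo (-1) 1) :
    Measurable (goodCoeffs.indicator fun c =>
      (({t ∈ Icc a b | seriesSum c t = 0}.encard : ℕ∞) : ℝ≥0∞)) := by
  have heq : (goodCoeffs.indicator fun c =>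
      (({t ∈ Icc a b | seriesSum c t = 0}.encard : ℕ∞) : ℝ≥0∞))
      = goodCoeffs.indicator fun c => ⨆ n : ℕ, ∑' j : ℤ,
        {c | PolyGrowth c ∧ ∃ t ∈ Icc a b, ⌊n * t⌋ = j ∧ seriesSum c t = 0}.indicator 1 c := by
    refine indicator_congr fun c hc => ?_
    rw [encard_eq_iSup_encard_floor (hc.1.finite_zeros hc.2 isCompact_Icc hab)]
    congr 1 with n
    rw [← ENNReal.tsum_set_one, tsum_subtype _ fun _ => 1]
    refine tsum_congr fun j => ?_
    have hiff : j ∈ (fun t : ℝ => ⌊n * t⌋) '' {t ∈ Icc a b | seriesSum c t = 0} ↔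
        c ∈ {c | PolyGrowth c ∧ ∃ t ∈ Icc a b, ⌊n * t⌋ = j ∧ seriesSum c t = 0} := by
      constructor
      · rintro ⟨t, ht, h⟩
        exact ⟨hc.1, t, ht.1, h, ht.2⟩
      · rintro ⟨_, t, ht, h, h0⟩
        exact ⟨t, ⟨ht, h0⟩, h⟩
    by_cases h : c ∈ {c | PolyGrowth c ∧ ∃ t ∈ Icc a b, ⌊n * t⌋ = j ∧ seriesSum c t = 0}
    · rw [indicator_of_mem h, indicator_of_mem (hiff.2 h)]; rfl
    · rw [indicator_of_notMem h, indicator_of_notMem (mt hiff.1 h)]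
  rw [heq]
  refine Measurable.indicator ?_ measurableSet_goodCoeffs
  exact .iSup fun n => Measurable.tsum fun j =>
    measurable_one.indicator (measurableSet_exists_zero_floor hab n j)

open Classical in
/-- The counting measure of the zeros in `[-r, r]`. -/
noncomputable def zeroMeasure (r : ℝ) (c : ℕ → ℝ) : Measure ℝ :=
  if c ∈ goodCoeffs then Measure.count.restrict {t ∈ Icc (-r) r | seriesSum c t = 0} else 0

theorem zeroMeasure_apply {r : ℝ} (hr : r < 1) {D : Set ℝ} (hD : MeasurableSet D) (c : ℕ → ℝ) :
    zeroMeasure r c D = goodCoeffs.indicator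
      (fun c => (({t ∈ Icc (-r) r | seriesSum c t = 0} ∩ D).encard : ℝ≥0∞)) c := by
  by_cases hc : c ∈ goodCoeffs
  · have hfin := hc.1.finite_zeros hc.2 (isCompact_Icc (a := -r) (b := r))
      (Icc_subset_Ioo (by linarith) hr)
    rw [zeroMeasure, if_pos hc, indicator_of_mem hc, Measure.restrict_apply hD,
      Measure.count_apply (hD.inter hfin.measurableSet), inter_comm]
  · simp [zeroMeasure, hc]

theorem measurable_zeroMeasure {r : ℝ} (hr : r < 1) : Measurable (zeroMeasure r) := by
  have hI : Icc (-r) r ⊆ Ioo (-1) 1 := Icc_subset_Ioo (by linarith) hr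
  have hfin : ∀ c, IsFiniteMeasure (zeroMeasure r c) := by
    intro c
    constructor
    rw [zeroMeasure_apply hr .univ]
    by_cases hc : c ∈ goodCoeffs
    · rw [indicator_of_mem hc, inter_univ, ENat.toENNReal_lt_top]
      exact (hc.1.finite_zeros hc.2 isCompact_Icc hI).encard_lt_top
    · simp [hc]
  have hbasic : ∀ a : ℝ, Measurable fun c => zeroMeasure r c (Iic a) := by
    intro a
    have := measurable_indicator_encard_zeros_Icc (a := -r) (b := min r a)
      ((Icc_subset_Icc_right (min_le_left _ _)).trans hI)
    convert this using 1
    ext c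
    rw [zeroMeasure_apply hr measurableSet_Iic]
    refine congrFun (indicator_congr fun c _ => ?_) c
    congr 2
    ext t
    simp only [Set.mem_ofPred_eq, mem_inter_iff, mem_Icc, mem_Iic, le_min_iff]
    tauto
  refine Measurable.measure_of_isPiSystem (S := range Iic)
    ((BorelSpace.measurable_eq (α := ℝ)).trans (borel_eq_generateFrom_Iic ℝ)) ?_ ?_ ?_
  · exact isPiSystem_Iic
  · rintro _ ⟨a, rfl⟩
    exact hbasic a
  · convert hbasic r using 1
    ext c
    rw [zeroMeasure_apply hr .univ, zeroMeasure_apply hr measurableSet_Iic]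
    refine congrFun (indicator_congr fun c _ => ?_) c
    congr 2
    ext t
    simp only [Set.mem_ofPred_eq, mem_inter_iff, mem_Icc, mem_Iic, mem_univ]
    tauto

/-- The zeros in `(-1, 1)` of the power series with coefficients `c`. -/
def zeroSet (c : ℕ → ℝ) : Set ℝ :=
  {t | t ∈ Ioo (-1 : ℝ) 1 ∧ HasSum (fun k : ℕ => c k * t ^ k) 0}

theorem PolyGrowth.mem_zeroSet {c : ℕ → ℝ} (hc : PolyGrowth c) {t : ℝ} :
    t ∈ zeroSet c ↔ t ∈ Ioo (-1 : ℝ) 1 ∧ seriesSum c t = 0 :=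
  and_congr_right fun ht =>
    ⟨fun h => h.tsum_eq, fun h => h ▸ hc.hasSum (abs_lt.2 ht)⟩

theorem measurable_indicator_encard_zeroSet {D : Set ℝ} (hD : MeasurableSet D) :
    Measurable (goodCoeffs.indicator fun c => ((zeroSet c ∩ D).encard : ℝ≥0∞)) := by
  set r : ℕ → ℝ := fun n => 1 - 1 / (n + 1 : ℝ)
  have hr : ∀ n, r n < 1 := fun n => sub_lt_self _ (by positivity)
  have heq : (goodCoeffs.indicator fun c => ((zeroSet c ∩ D).encard : ℝ≥0∞))
      = fun c => ⨆ n, zeroMeasure (r n) c D := by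
    ext c
    simp_rw [zeroMeasure_apply (hr _) hD]
    by_cases hc : c ∈ goodCoeffs
    · simp only [indicator_of_mem hc]
      let m : MeasurableSpace ℝ := ⊤
      have hm : ∀ t : Set ℝ, MeasurableSet t := fun _ => MeasurableSpace.measurableSet_top
      simp_rw [← Measure.count_apply (hm _)]
      rw [← Monotone.measure_iUnion]
      · congr 1
        ext t
        simp only [mem_inter_iff, mem_iUnion, Set.mem_ofPred_eq, hc.1.mem_zeroSet]
        constructor
        · rintro ⟨⟨h1, h2⟩, h3⟩
          obtain ⟨n, hn⟩ := exists_nat_one_div_lt (sub_pos.2 (abs_lt.2 h1))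
          refine ⟨n, ⟨abs_le.1 ?_, h2⟩, h3⟩
          simp only [r]
          linarith
        · rintro ⟨n, ⟨h1, h2⟩, h3⟩
          exact ⟨⟨Icc_subset_Ioo (by linarith [hr n]) (hr n) h1, h2⟩, h3⟩
      · intro i j hij t ht
        have : r i ≤ r j := by
          simp only [r]
          gcongr
        exact ⟨⟨Icc_subset_Icc (by linarith) this ht.1.1, ht.1.2⟩, ht.2⟩
    · simp [hc]
  rw [heq]
  exact .iSup fun n => (Measure.measurable_coe hD).comp (measurable_zeroMeasure (hr n))

end ZeroCounting

section CoefficientLaw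

/-- The law of a sequence of i.i.d. standard Gaussian random variables. -/
noncomputable def coeffLaw : Measure (ℕ → ℝ) := Measure.infinitePi fun _ => gaussianReal 0 1

instance : IsProbabilityMeasure coeffLaw := by unfold coeffLaw; infer_instance

theorem measurePreserving_coeff (k : ℕ) :
    MeasurePreserving (fun c : ℕ → ℝ => c k) coeffLaw (gaussianReal 0 1) :=
  measurePreserving_eval_infinitePi (fun _ : ℕ => gaussianReal 0 1) k

theorem ae_polyGrowth : ∀ᵐ c ∂coeffLaw, PolyGrowth c := by
  set M : ℝ≥0∞ := ∫⁻ x, ‖x‖ₑ ∂gaussianReal 0 1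
  have hM : M ≠ ∞ := by
    have := (memLp_one_iff_integrable.1 (memLp_id_gaussianReal (μ := 0) (v := 1) 1))
    exact this.2.ne
  have hsum : Summable fun k : ℕ => (((k : ℝ≥0) + 1) ^ 2)⁻¹ := by
    rw [← NNReal.summable_coe]
    have := (summable_nat_add_iff 1).2 (Real.summable_nat_pow_inv.2 one_lt_two)
    simpa using this
  have hlt : ∫⁻ c, ∑' k : ℕ, ‖c k‖ₑ * ((((k : ℝ≥0) + 1) ^ 2)⁻¹ : ℝ≥0) ∂coeffLaw ≠ ∞ := by
    rw [lintegral_tsum fun k => Measurable.aemeasurable (by fun_prop)]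
    have : ∀ k : ℕ, ∫⁻ c, ‖c k‖ₑ * ((((k : ℝ≥0) + 1) ^ 2)⁻¹ : ℝ≥0) ∂coeffLaw
        = M * ((((k : ℝ≥0) + 1) ^ 2)⁻¹ : ℝ≥0) := by
      intro k
      rw [lintegral_mul_const _ (by fun_prop),
        (measurePreserving_coeff k).lintegral_comp (f := fun x => ‖x‖ₑ) (by fun_prop)]
    simp_rw [this]
    rw [ENNReal.tsum_mul_left]
    exact ENNReal.mul_ne_top hM (ENNReal.tsum_coe_ne_top_iff_summable.2 hsum)
  have hmeas : Measurable fun c : ℕ → ℝ =>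
      ∑' k : ℕ, ‖c k‖ₑ * ((((k : ℝ≥0) + 1) ^ 2)⁻¹ : ℝ≥0) :=
    Measurable.tsum fun k => by fun_prop
  filter_upwards [ae_lt_top hmeas hlt] with c hc
  set S := ∑' k : ℕ, ‖c k‖ₑ * ((((k : ℝ≥0) + 1) ^ 2)⁻¹ : ℝ≥0)
  refine PolyGrowth.of_le (C := S.toReal) (m := 2) fun k => ?_
  have h1 : ‖c k‖ₑ * ((((k : ℝ≥0) + 1) ^ 2)⁻¹ : ℝ≥0) ≤ S :=
    ENNReal.le_tsum (f := fun k : ℕ => ‖c k‖ₑ * ((((k : ℝ≥0) + 1) ^ 2)⁻¹ : ℝ≥0)) k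
  have h2 := ENNReal.toReal_mono hc.ne h1
  rw [ENNReal.toReal_mul, toReal_enorm, ENNReal.coe_toReal, Real.norm_eq_abs] at h2
  push_cast at h2
  rwa [← div_eq_mul_inv, div_le_iff₀ (by positivity)] at h2

theorem ae_goodCoeffs : ∀ᵐ c ∂coeffLaw, c ∈ goodCoeffs := by
  have h0 : ∀ᵐ x ∂gaussianReal 0 1, x ≠ 0 := by
    have : NullSingletonClass (gaussianReal 0 1) := nullSingletonClass_gaussianReal one_ne_zero
    exact Measure.ae_ne _ 0
  filter_upwards [ae_polyGrowth, (measurePreserving_coeff 0).quasiMeasurePreserving.ae h0]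
    with c h1 h2 using ⟨h1, h2⟩

theorem aemeasurable_encard_zeroSet {D : Set ℝ} (hD : MeasurableSet D) :
    AEMeasurable (fun c => ((zeroSet c ∩ D).encard : ℝ≥0∞)) coeffLaw :=
  ⟨_, measurable_indicator_encard_zeroSet hD, by
    filter_upwards [ae_goodCoeffs] with c hc
    rw [indicator_of_mem hc]⟩

/-- Prepending an independent standard Gaussian coefficient preserves the law. -/
theorem measurePreserving_cons :
    MeasurePreserving (fun p : ℝ × (ℕ → ℝ) => (fun k => Nat.casesOn k p.1 p.2 : ℕ → ℝ))
      ((gaussianReal 0 1).prod coeffLaw) coeffLaw := by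
  have hmeas : Measurable (fun p : ℝ × (ℕ → ℝ) => (fun k => Nat.casesOn k p.1 p.2 : ℕ → ℝ)) := by
    refine measurable_pi_lambda _ fun k => ?_
    cases k with
    | zero => exact measurable_fst
    | succ k => exact (measurable_pi_apply k).comp measurable_snd
  refine ⟨hmeas, Measure.eq_infinitePi _ fun s t ht => ?_⟩
  classical
  set s' : Finset ℕ := s.preimage Nat.succ Nat.succ_injective.injOn
  set t₀ : Set ℝ := if 0 ∈ s then t 0 else univ
  have ht₀ : MeasurableSet t₀ := by
    simp only [t₀]; split_ifs
    exacts [ht 0, .univ]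
  have hpre : (fun p : ℝ × (ℕ → ℝ) => (fun k => Nat.casesOn k p.1 p.2 : ℕ → ℝ)) ⁻¹' Set.pi s t
      = t₀ ×ˢ Set.pi s' fun k => t (k + 1) := by
    ext p
    simp only [mem_preimage, Set.mem_pi, SetLike.mem_coe, mem_prod, s', Finset.mem_preimage, t₀]
    constructor
    · intro h
      refine ⟨?_, fun k hk => h (k + 1) hk⟩
      split_ifs with h0
      · exact h 0 h0
      · trivial
    · rintro ⟨h0, h1⟩ k hk
      cases k with
      | zero => simpa [hk] using h0
      | succ k => exact h1 k hk
  rw [Measure.map_apply hmeas (MeasurableSet.pi s.countable_toSet fun k _ => ht k), hpre,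
    Measure.prod_prod, coeffLaw, Measure.infinitePi_pi _ fun k _ => ht (k + 1)]
  have himg : ∏ k ∈ s', gaussianReal 0 1 (t (k + 1))
      = ∏ k ∈ s.erase 0, gaussianReal 0 1 (t k) := by
    refine Finset.prod_bij (fun k _ => k + 1) ?_ ?_ ?_ ?_
    · intro k hk
      simpa [s'] using hk
    · intro a _ b _ h
      exact Nat.succ_injective h
    · intro b hb
      obtain ⟨h0, hb⟩ := Finset.mem_erase.1 hb
      obtain ⟨k, rfl⟩ := Nat.exists_eq_succ_of_ne_zero h0
      exact ⟨k, by simpa [s'] using hb, rfl⟩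
    · intro k _
      rfl
  rw [himg]
  by_cases h0 : 0 ∈ s
  · simp only [t₀, h0, if_true]
    exact Finset.mul_prod_erase s (fun k => gaussianReal 0 1 (t k)) h0
  · simp [t₀, h0]

/-- The characteristic function of a linear functional of the coefficients. -/
theorem integral_exp_linear {w : ℕ → ℝ} {W : ℝ} (hw : HasSum (fun k => w k ^ 2) W)
    {X : (ℕ → ℝ) → ℝ} (hX : ∀ᵐ c ∂coeffLaw, HasSum (fun k => c k * w k) (X c)) :
    ∫ c, Complex.exp (X c * Complex.I) ∂coeffLaw = Complex.exp (-W / 2) := by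
  have hfin : ∀ n : ℕ, ∫ c, Complex.exp (((∑ k ∈ Finset.range n, c k * w k : ℝ) : ℂ) * Complex.I)
      ∂coeffLaw = Complex.exp (-(∑ k ∈ Finset.range n, w k ^ 2 : ℝ) / 2) := by
    intro n
    have hind : iIndepFun (fun k (c : ℕ → ℝ) => w k * c k) coeffLaw :=
      iIndepFun_infinitePi (X := fun k x => w k * x) fun k => by fun_prop
    have h := iIndepFun.charFun_map_fun_finsetSum_eq_prod (P := coeffLaw)
      (X := fun k (c : ℕ → ℝ) => w k * c k) (s := Finset.range n)
      (fun k _ => Measurable.aemeasurable (by fun_prop)) (hind.restrict _)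
    have h1 := congrFun h 1
    rw [charFun_apply_real, integral_map (Measurable.aemeasurable (by fun_prop)) (by fun_prop),
      Finset.prod_apply] at h1
    have h2 : ∀ k, charFun (coeffLaw.map fun c => w k * c k) 1
        = Complex.exp (-(w k ^ 2 : ℝ) / 2) := by
      intro k
      rw [charFun_map_mul_comp (Measurable.aemeasurable (by fun_prop)), (measurePreserving_coeff k).map_eq,
        charFun_gaussianReal]
      congr 1
      push_cast
      ring
    simp_rw [h2, ← Complex.exp_sum] at h1
    convert h1 using 2
    · ext c
      simp [mul_comm]
    · push_cast
      rw [← Finset.sum_div, Finset.sum_neg_distrib]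
  have hlim : Tendsto (fun n : ℕ => ∫ c, Complex.exp
      (((∑ k ∈ Finset.range n, c k * w k : ℝ) : ℂ) * Complex.I) ∂coeffLaw) atTop
      (𝓝 (∫ c, Complex.exp (X c * Complex.I) ∂coeffLaw)) := by
    refine tendsto_integral_of_dominated_convergence (fun _ => 1) (fun n => ?_)
      (integrable_const _) (fun n => ae_of_all _ fun c => ?_) ?_
    · exact Measurable.aestronglyMeasurable (by fun_prop)
    · rw [Complex.norm_exp_ofReal_mul_I]
    · filter_upwards [hX] with c hc
      exact ((Complex.continuous_exp.comp (by fun_prop : Continuous fun x : ℝ =>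
        (x : ℂ) * Complex.I)).tendsto _).comp hc.tendsto_sum_nat
  refine tendsto_nhds_unique hlim ?_
  simp_rw [hfin]
  exact ((Complex.continuous_exp.comp (by fun_prop : Continuous fun x : ℝ =>
    -(x : ℂ) / 2)).tendsto _).comp hw.tendsto_sum_nat

end CoefficientLaw

section KacRice

/-- The function `t ^ n * ∑ k, c k * t ^ k`. -/
noncomputable def tail (n : ℕ) (c : ℕ → ℝ) (t : ℝ) : ℝ := t ^ n * seriesSum c t

/-- The derivative of `tail n c`. -/
noncomputable def tailDeriv (n : ℕ) (c : ℕ → ℝ) (t : ℝ) : ℝ :=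
  n * t ^ (n - 1) * seriesSum c t + t ^ n * seriesSum (derivCoeff c) t

theorem PolyGrowth.hasDerivAt_tail {c : ℕ → ℝ} (hc : PolyGrowth c) (n : ℕ) {t : ℝ}
    (ht : |t| < 1) : HasDerivAt (tail n c) (tailDeriv n c t) t :=
  (hasDerivAt_pow n t).mul (hc.hasDerivAt ht)

theorem measurable_tail (n : ℕ) : Measurable fun p : (ℕ → ℝ) × ℝ => tail n p.1 p.2 :=
  (measurable_snd.pow_const n).mul measurable_seriesSum

theorem measurable_tailDeriv (n : ℕ) : Measurable fun p : (ℕ → ℝ) × ℝ => tailDeriv n p.1 p.2 :=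
  ((measurable_const.mul (measurable_snd.pow_const _)).mul measurable_seriesSum).add
    ((measurable_snd.pow_const n).mul
      (measurable_seriesSum.comp ((measurable_derivCoeff.comp measurable_fst).prodMk measurable_snd)))

/-- Integration over the law of the coefficients, some of which are integrated out first. -/
theorem lintegral_coeffLaw_eq {X : Type*} [MeasurableSpace X] {ν : Measure X} [SFinite ν]
    {T : X × (ℕ → ℝ) → ℕ → ℝ} (hT : MeasurePreserving T (ν.prod coeffLaw) coeffLaw)
    {G : (ℕ → ℝ) → ℝ≥0∞} (hG : AEMeasurable G coeffLaw) :
    ∫⁻ c, G c ∂coeffLaw = ∫⁻ c, ∫⁻ x, G (T (x, c)) ∂ν ∂coeffLaw := by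
  have hG' : AEMeasurable G ((ν.prod coeffLaw).map T) := by rwa [hT.map_eq]
  conv_lhs => rw [← hT.map_eq]
  rw [lintegral_map' hG' hT.aemeasurable]
  exact lintegral_prod_symm _ (hG.comp_quasiMeasurePreserving hT.quasiMeasurePreserving)

theorem lintegral_gaussianReal_eq (G : ℝ → ℝ≥0∞) :
    ∫⁻ x, G x ∂gaussianReal 0 1 = ∫⁻ x, G x * gaussianPDF 0 1 x := by
  rw [gaussianReal_of_var_ne_zero 0 one_ne_zero,
    lintegral_withDensity_eq_lintegral_mul_non_measurable _ (measurable_gaussianPDF 0 1)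
      (ae_of_all _ fun _ => gaussianPDF_lt_top)]
  simp [mul_comm]

theorem lintegral_gaussianReal_prod_eq (G : ℝ × ℝ → ℝ≥0∞) :
    ∫⁻ x, G x ∂(gaussianReal 0 1).prod (gaussianReal 0 1)
      = ∫⁻ x, G x * (gaussianPDF 0 1 x.1 * gaussianPDF 0 1 x.2) := by
  rw [gaussianReal_of_var_ne_zero 0 one_ne_zero,
    prod_withDensity (measurable_gaussianPDF 0 1) (measurable_gaussianPDF 0 1),
    lintegral_withDensity_eq_lintegral_mul_non_measurable _ (by fun_prop)
      (ae_of_all _ fun _ => ENNReal.mul_lt_top gaussianPDF_lt_top gaussianPDF_lt_top),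
    Measure.volume_eq_prod]
  simp [mul_comm]

/-- The one-point Kac–Rice formula. -/
theorem lintegral_encard_zeroSet {D : Set ℝ} (hD : MeasurableSet D) (hDI : D ⊆ Ioo (-1) 1) :
    ∫⁻ c, ((zeroSet c ∩ D).encard : ℝ≥0∞) ∂coeffLaw = ∫⁻ t in D, ∫⁻ c,
      ENNReal.ofReal |tailDeriv 1 c t| * gaussianPDF 0 1 (-tail 1 c t) ∂coeffLaw := by
  have hmeas : Measurable (uncurry fun (t : ℝ) (c : ℕ → ℝ) =>
      ENNReal.ofReal |tailDeriv 1 c t| * gaussianPDF 0 1 (-tail 1 c t)) := by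
    have h1 := (measurable_tailDeriv 1).comp (measurable_swap (α := ℝ) (β := ℕ → ℝ))
    have h2 := (measurable_tail 1).comp (measurable_swap (α := ℝ) (β := ℕ → ℝ))
    exact (h1.abs.ennreal_ofReal).mul ((measurable_gaussianPDF 0 1).comp h2.neg)
  rw [lintegral_lintegral_swap hmeas.aemeasurable,
    lintegral_coeffLaw_eq measurePreserving_cons (aemeasurable_encard_zeroSet hD)]
  refine lintegral_congr_ae ?_
  filter_upwards [ae_polyGrowth] with c hc
  rw [lintegral_gaussianReal_eq]
  have hfib : ∀ x : ℝ, zeroSet (fun k => Nat.casesOn k x c) ∩ D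
      = D ∩ (fun t => -tail 1 c t) ⁻¹' {x} := by
    intro x
    ext t
    rw [mem_inter_iff, (hc.cons x).mem_zeroSet, mem_inter_iff, mem_preimage, mem_singleton_iff]
    constructor
    · rintro ⟨⟨h1, h2⟩, h3⟩
      rw [hc.seriesSum_cons x (abs_lt.2 h1)] at h2
      exact ⟨h3, by rw [tail]; linarith⟩
    · rintro ⟨h3, h2⟩
      refine ⟨⟨hDI h3, ?_⟩, h3⟩
      rw [hc.seriesSum_cons x (abs_lt.2 (hDI h3))]
      rw [tail] at h2
      linarith
  simp_rw [hfib]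
  rw [lintegral_encard_fiber_mul (f := fun t => -tail 1 c t) (f' := fun t => ContinuousLinearMap.toSpanSingleton ℝ
    (-tailDeriv 1 c t)) volume hD (fun t ht => (hc.hasDerivAt_tail 1
      (abs_lt.2 (hDI ht))).neg.hasFDerivAt) ?_ (measurable_gaussianPDF 0 1)]
  · simp_rw [ContinuousLinearMap.det_toSpanSingleton, abs_neg]
  · simp_rw [ContinuousLinearMap.det_toSpanSingleton]
    exact hD.inter (measurableSet_eq_fun
      ((measurable_tailDeriv 1).comp (measurable_const.prodMk measurable_id)).neg measurable_const)

/-- The value of the linear coefficient for which the series, all of whose coefficients of order at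
least two are given, has the same value at `z.1` and `z.2`. -/
noncomputable def slope (c : ℕ → ℝ) (z : ℝ × ℝ) : ℝ := (tail 2 c z.1 - tail 2 c z.2) / (z.2 - z.1)

/-- The first two coefficients of the series that vanishes at `z.1` and `z.2` and whose other
coefficients are given. -/
noncomputable def twoZeros (c : ℕ → ℝ) (z : ℝ × ℝ) : ℝ × ℝ :=
  (-tail 2 c z.1 - z.1 * slope c z, slope c z)

/-- The product of the derivatives at `z.1` and `z.2` of the series that vanishes there. -/
noncomputable def derivProd (c : ℕ → ℝ) (z : ℝ × ℝ) : ℝ :=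
  (tailDeriv 2 c z.1 + slope c z) * (tailDeriv 2 c z.2 + slope c z)

/-- The derivative of `twoZeros`. -/
noncomputable def twoZerosDeriv (c : ℕ → ℝ) (z : ℝ × ℝ) : ℝ × ℝ →L[ℝ] ℝ × ℝ :=
  ((-(tailDeriv 2 c z.1 + slope c z) * z.2 / (z.2 - z.1)) • ContinuousLinearMap.fst ℝ ℝ ℝ
    + ((tailDeriv 2 c z.2 + slope c z) * z.1 / (z.2 - z.1)) • ContinuousLinearMap.snd ℝ ℝ ℝ).prod
  (((tailDeriv 2 c z.1 + slope c z) / (z.2 - z.1)) • ContinuousLinearMap.fst ℝ ℝ ℝ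
    + (-(tailDeriv 2 c z.2 + slope c z) / (z.2 - z.1)) • ContinuousLinearMap.snd ℝ ℝ ℝ)

theorem PolyGrowth.hasFDerivAt_twoZeros {c : ℕ → ℝ} (hc : PolyGrowth c) {z : ℝ × ℝ}
    (h1 : |z.1| < 1) (h2 : |z.2| < 1) (hz : z.1 ≠ z.2) :
    HasFDerivAt (twoZeros c) (twoZerosDeriv c z) z := by
  have hz' : z.2 - z.1 ≠ 0 := sub_ne_zero.2 hz.symm
  have hf : HasFDerivAt (fun z : ℝ × ℝ => z.1) (ContinuousLinearMap.fst ℝ ℝ ℝ) z :=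
    hasFDerivAt_fst
  have hg : HasFDerivAt (fun z : ℝ × ℝ => z.2) (ContinuousLinearMap.snd ℝ ℝ ℝ) z :=
    hasFDerivAt_snd
  have hT1 : HasFDerivAt (fun z : ℝ × ℝ => tail 2 c z.1) _ z :=
    (hc.hasDerivAt_tail 2 h1).comp_hasFDerivAt z hf
  have hT2 : HasFDerivAt (fun z : ℝ × ℝ => tail 2 c z.2) _ z :=
    (hc.hasDerivAt_tail 2 h2).comp_hasFDerivAt z hg
  have hinv : HasFDerivAt (fun z : ℝ × ℝ => (z.2 - z.1)⁻¹) _ z :=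
    (hasDerivAt_inv hz').comp_hasFDerivAt z (hg.sub hf)
  have hs : HasFDerivAt (slope c) (((tailDeriv 2 c z.1 + slope c z) / (z.2 - z.1)) •
      ContinuousLinearMap.fst ℝ ℝ ℝ
      + (-(tailDeriv 2 c z.2 + slope c z) / (z.2 - z.1)) • ContinuousLinearMap.snd ℝ ℝ ℝ) z := by
    have h := (hT1.sub hT2).mul hinv
    refine HasFDerivAt.congr_fderiv (f' := _) h ?_
    ext
    · simp [slope]; field_simp; ring
    · simp [slope]; field_simp
  refine HasFDerivAt.prodMk ?_ hs
  refine HasFDerivAt.congr_fderiv (hT1.neg.sub (hf.mul hs)) ?_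
  ext
  · simp; field_simp; ring
  · simp; field_simp; ring

theorem det_twoZerosDeriv (c : ℕ → ℝ) {z : ℝ × ℝ} (hz : z.1 ≠ z.2) :
    (twoZerosDeriv c z).det = derivProd c z / (z.2 - z.1) := by
  have hz' : z.2 - z.1 ≠ 0 := sub_ne_zero.2 hz.symm
  rw [twoZerosDeriv, ← Matrix.toLin_finTwoProd_toContinuousLinearMap, ContinuousLinearMap.det,
    LinearMap.coe_toContinuousLinearMap, LinearMap.det_toLin, Matrix.det_fin_two_of, derivProd]
  field_simp

theorem measurable_slope : Measurable fun p : (ℕ → ℝ) × (ℝ × ℝ) => slope p.1 p.2 := by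
  have h1 := (measurable_tail 2).comp
    (measurable_fst.prodMk (measurable_fst.comp measurable_snd) :
      Measurable fun p : (ℕ → ℝ) × (ℝ × ℝ) => (p.1, p.2.1))
  have h2 := (measurable_tail 2).comp
    (measurable_fst.prodMk (measurable_snd.comp measurable_snd) :
      Measurable fun p : (ℕ → ℝ) × (ℝ × ℝ) => (p.1, p.2.2))
  exact (h1.sub h2).div (by fun_prop)

theorem measurable_twoZeros : Measurable fun p : (ℕ → ℝ) × (ℝ × ℝ) => twoZeros p.1 p.2 := by
  have h1 := (measurable_tail 2).comp
    (measurable_fst.prodMk (measurable_fst.comp measurable_snd) :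
      Measurable fun p : (ℕ → ℝ) × (ℝ × ℝ) => (p.1, p.2.1))
  exact (h1.neg.sub (Measurable.mul (by fun_prop) measurable_slope)).prodMk measurable_slope

theorem measurable_derivProd : Measurable fun p : (ℕ → ℝ) × (ℝ × ℝ) => derivProd p.1 p.2 := by
  have h1 := (measurable_tailDeriv 2).comp
    (measurable_fst.prodMk (measurable_fst.comp measurable_snd) :
      Measurable fun p : (ℕ → ℝ) × (ℝ × ℝ) => (p.1, p.2.1))
  have h2 := (measurable_tailDeriv 2).comp
    (measurable_fst.prodMk (measurable_snd.comp measurable_snd) :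
      Measurable fun p : (ℕ → ℝ) × (ℝ × ℝ) => (p.1, p.2.2))
  exact (h1.add measurable_slope).mul (h2.add measurable_slope)

theorem measurePreserving_cons_cons :
    MeasurePreserving (fun p : (ℝ × ℝ) × (ℕ → ℝ) =>
      (fun k => Nat.casesOn k p.1.1 (fun k => Nat.casesOn k p.1.2 p.2) : ℕ → ℝ))
      (((gaussianReal 0 1).prod (gaussianReal 0 1)).prod coeffLaw) coeffLaw :=
  measurePreserving_cons.comp
    (((MeasurePreserving.id (gaussianReal 0 1)).prod measurePreserving_cons).comp
      (measurePreserving_prodAssoc (gaussianReal 0 1) (gaussianReal 0 1) coeffLaw))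

theorem PolyGrowth.zeroSet_cons_cons_inter_prod {c : ℕ → ℝ} (hc : PolyGrowth c) {D₁ D₂ : Set ℝ}
    (hD₁ : D₁ ⊆ Ioo (-1) 1) (hD₂ : D₂ ⊆ Ioo (-1) 1) (hdisj : Disjoint D₁ D₂) (x : ℝ × ℝ) :
    (zeroSet (fun k => Nat.casesOn k x.1 (fun k => Nat.casesOn k x.2 c)) ∩ D₁) ×ˢ
      (zeroSet (fun k => Nat.casesOn k x.1 (fun k => Nat.casesOn k x.2 c)) ∩ D₂)
      = (D₁ ×ˢ D₂) ∩ twoZeros c ⁻¹' {x} := by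
  obtain ⟨x₀, x₁⟩ := x
  ext ⟨s, t⟩
  simp only [mem_prod, mem_inter_iff, mem_preimage, mem_singleton_iff,
    ((hc.cons x₁).cons x₀).mem_zeroSet]
  by_cases hst : s ∈ D₁ ∧ t ∈ D₂
  · obtain ⟨hs, ht⟩ := hst
    have hne : t - s ≠ 0 := sub_ne_zero.2 (hdisj.ne_of_mem hs ht).symm
    have hs1 := abs_lt.2 (hD₁ hs)
    have ht1 := abs_lt.2 (hD₂ ht)
    rw [(hc.cons x₁).seriesSum_cons x₀ hs1, (hc.cons x₁).seriesSum_cons x₀ ht1,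
      hc.seriesSum_cons x₁ hs1, hc.seriesSum_cons x₁ ht1]
    simp only [hs, ht, hD₁ hs, hD₂ ht, true_and, and_true, twoZeros, slope, tail, Prod.mk.injEq]
    constructor
    · rintro ⟨h1, h2⟩
      have : (s ^ 2 * seriesSum c s - t ^ 2 * seriesSum c t) / (t - s) = x₁ := by
        rw [div_eq_iff hne]; linear_combination h1 - h2
      rw [this]
      exact ⟨by linear_combination -h1, rfl⟩
    · rintro ⟨h1, h2⟩
      rw [h2] at h1
      rw [div_eq_iff hne] at h2
      exact ⟨by linear_combination -h1, by linear_combination -h1 - h2⟩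
  · constructor
    · rintro ⟨h1, h2⟩
      exact absurd ⟨h1.2, h2.2⟩ hst
    · rintro ⟨h1, h2⟩
      exact absurd h1 hst

/-- The two-point Kac–Rice formula. -/
theorem lintegral_encard_zeroSet_mul {D₁ D₂ : Set ℝ} (hD₁ : MeasurableSet D₁)
    (hD₂ : MeasurableSet D₂) (hI₁ : D₁ ⊆ Ioo (-1) 1) (hI₂ : D₂ ⊆ Ioo (-1) 1)
    (hdisj : Disjoint D₁ D₂) :
    ∫⁻ c, ((zeroSet c ∩ D₁).encard : ℝ≥0∞) * ((zeroSet c ∩ D₂).encard : ℝ≥0∞) ∂coeffLaw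
      = ∫⁻ z in D₁ ×ˢ D₂, ∫⁻ c, ENNReal.ofReal |derivProd c z / (z.2 - z.1)| *
        (gaussianPDF 0 1 (twoZeros c z).1 * gaussianPDF 0 1 (twoZeros c z).2) ∂coeffLaw := by
  have hmeas : Measurable (uncurry fun (z : ℝ × ℝ) (c : ℕ → ℝ) =>
      ENNReal.ofReal |derivProd c z / (z.2 - z.1)| *
        (gaussianPDF 0 1 (twoZeros c z).1 * gaussianPDF 0 1 (twoZeros c z).2)) := by
    have h1 := measurable_derivProd.comp (measurable_swap (α := ℝ × ℝ) (β := ℕ → ℝ))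
    have h2 := measurable_twoZeros.comp (measurable_swap (α := ℝ × ℝ) (β := ℕ → ℝ))
    exact ((h1.div (by fun_prop : Measurable fun q : (ℝ × ℝ) × (ℕ → ℝ) =>
      q.1.2 - q.1.1)).abs.ennreal_ofReal).mul
      (((measurable_gaussianPDF 0 1).comp h2.fst).mul ((measurable_gaussianPDF 0 1).comp h2.snd))
  rw [lintegral_lintegral_swap hmeas.aemeasurable,
    lintegral_coeffLaw_eq measurePreserving_cons_cons (G := fun c =>
      ((zeroSet c ∩ D₁).encard : ℝ≥0∞) * ((zeroSet c ∩ D₂).encard : ℝ≥0∞))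
      ((aemeasurable_encard_zeroSet hD₁).mul (aemeasurable_encard_zeroSet hD₂))]
  refine lintegral_congr_ae ?_
  filter_upwards [ae_polyGrowth] with c hc
  rw [lintegral_gaussianReal_prod_eq]
  have hne : ∀ z ∈ D₁ ×ˢ D₂, z.1 ≠ z.2 := fun z hz => hdisj.ne_of_mem hz.1 hz.2
  have hfib : ∀ x : ℝ × ℝ,
      ((zeroSet (fun k => Nat.casesOn k x.1 (fun k => Nat.casesOn k x.2 c)) ∩ D₁).encard : ℝ≥0∞) *
      ((zeroSet (fun k => Nat.casesOn k x.1 (fun k => Nat.casesOn k x.2 c)) ∩ D₂).encard : ℝ≥0∞)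
      = (((D₁ ×ˢ D₂) ∩ twoZeros c ⁻¹' {x}).encard : ℝ≥0∞) := by
    intro x
    rw [← hc.zeroSet_cons_cons_inter_prod hI₁ hI₂ hdisj, encard_prod, ENat.toENNReal_mul]
  simp_rw [hfib]
  have hset : {z ∈ D₁ ×ˢ D₂ | (twoZerosDeriv c z).det = 0}
      = {z ∈ D₁ ×ˢ D₂ | derivProd c z / (z.2 - z.1) = 0} := by
    ext z
    exact and_congr_right fun hz => by rw [det_twoZerosDeriv c (hne z hz)]
  rw [lintegral_encard_fiber_mul (f' := twoZerosDeriv c) volume (hD₁.prod hD₂)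
    (fun z hz => hc.hasFDerivAt_twoZeros (abs_lt.2 (hI₁ hz.1)) (abs_lt.2 (hI₂ hz.2)) (hne z hz))
    ?_ (g := fun x => gaussianPDF 0 1 x.1 * gaussianPDF 0 1 x.2) (by fun_prop)]
  · refine setLIntegral_congr_fun (hD₁.prod hD₂) fun z hz => ?_
    simp only [det_twoZerosDeriv c (hne z hz)]
  · rw [hset]
    exact (hD₁.prod hD₂).inter (measurableSet_eq_fun
      ((measurable_derivProd.comp (measurable_const.prodMk measurable_id)).div (by fun_prop))
      measurable_const)

end KacRice

section Moments

theorem gaussianPDFReal_std (x : ℝ) :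
    gaussianPDFReal 0 1 x = (√(2 * Real.pi))⁻¹ * Real.exp (-x ^ 2 / 2) := by
  simp [gaussianPDFReal]

theorem integral_mul_exp_neg_sq_div_two : ∫ r in Ioi (0 : ℝ), r * Real.exp (-r ^ 2 / 2) = 1 := by
  have h := integral_rpow_mul_exp_neg_mul_rpow (p := 2) (q := 1) (b := 1 / 2) two_pos
    (by norm_num) (by norm_num)
  have h1 : ((1 : ℝ) + 1) / 2 = 1 := by norm_num
  have h2 : -((1 : ℝ) + 1) / 2 = -1 := by norm_num
  rw [h1, h2, Real.Gamma_one, Real.rpow_neg_one] at h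
  norm_num at h
  rw [← h]
  refine setIntegral_congr_fun measurableSet_Ioi fun r _ => ?_
  congr 2
  ring

theorem integral_pow_three_mul_exp_neg_sq_div_two :
    ∫ r in Ioi (0 : ℝ), r ^ 3 * Real.exp (-r ^ 2 / 2) = 2 := by
  have h := integral_rpow_mul_exp_neg_mul_rpow (p := 2) (q := 3) (b := 1 / 2) two_pos
    (by norm_num) (by norm_num)
  have h1 : ((3 : ℝ) + 1) / 2 = 2 := by norm_num
  have h2 : -((3 : ℝ) + 1) / 2 = -2 := by norm_num
  rw [h1, h2, Real.Gamma_two, Real.rpow_neg (by norm_num), Real.rpow_two] at h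
  norm_num at h
  refine (setIntegral_congr_fun measurableSet_Ioi fun r _ => ?_).trans h
  congr 2
  ring

/-- The first absolute moment of the standard Gaussian distribution. -/
theorem lintegral_abs_gaussianReal :
    ∫⁻ x, ENNReal.ofReal |x| ∂gaussianReal 0 1 = ENNReal.ofReal (2 / √(2 * Real.pi)) := by
  rw [lintegral_gaussianReal_eq]
  have h : ∫ x : ℝ, |x| * gaussianPDFReal 0 1 x = 2 / √(2 * Real.pi) := by
    have h1 := integral_comp_abs (f := fun x => x * gaussianPDFReal 0 1 x)
    have h2 : ∀ x : ℝ, gaussianPDFReal 0 1 |x| = gaussianPDFReal 0 1 x := fun x => by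
      rw [gaussianPDFReal_std, gaussianPDFReal_std, sq_abs]
    simp_rw [h2] at h1
    rw [h1]
    simp_rw [gaussianPDFReal_std]
    have h3 : ∀ x : ℝ, x * ((√(2 * Real.pi))⁻¹ * Real.exp (-x ^ 2 / 2))
        = (√(2 * Real.pi))⁻¹ * (x * Real.exp (-x ^ 2 / 2)) := fun x => by ring
    simp_rw [h3]
    rw [integral_const_mul, integral_mul_exp_neg_sq_div_two]
    ring
  rw [← h, ofReal_integral_eq_lintegral_ofReal]
  · refine lintegral_congr fun x => ?_
    rw [gaussianPDF, ENNReal.ofReal_mul (abs_nonneg x)]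
  · by_contra hni
    rw [integral_undef hni] at h
    have : (0 : ℝ) < 2 / √(2 * Real.pi) := by positivity
    exact this.ne h
  · exact ae_of_all _ fun x => mul_nonneg (abs_nonneg x) (gaussianPDFReal_nonneg 0 1 x)

theorem integral_abs_cos_add_cos {α : ℝ} (h0 : 0 ≤ α) (hπ : α ≤ Real.pi) :
    ∫ φ in (-Real.pi)..Real.pi, |Real.cos α + Real.cos φ|
      = 2 * (Real.cos α * (Real.pi - 2 * α) + 2 * Real.sin α) := by
  have hint : ∀ a b : ℝ, IntervalIntegrable (fun φ => |Real.cos α + Real.cos φ|) volume a b :=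
    fun a b => Continuous.intervalIntegrable (by fun_prop) a b
  have hprim : ∀ a b : ℝ, ∫ φ in a..b, (Real.cos α + Real.cos φ)
      = Real.cos α * (b - a) + (Real.sin b - Real.sin a) := by
    intro a b
    rw [intervalIntegral.integral_add (by simp) (Continuous.intervalIntegrable (by fun_prop) a b)]
    simp [mul_comm]
  have hpos : ∫ φ in (0 : ℝ)..(Real.pi - α), |Real.cos α + Real.cos φ|
      = Real.cos α * (Real.pi - α) + Real.sin α := by
    rw [intervalIntegral.integral_congr (g := fun φ => Real.cos α + Real.cos φ), hprim]
    · simp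
    · intro φ hφ
      rw [uIcc_of_le (by linarith)] at hφ
      refine abs_of_nonneg ?_
      have := Real.cos_le_cos_of_nonneg_of_le_pi hφ.1 (by linarith) hφ.2
      rw [Real.cos_pi_sub] at this
      linarith
  have hneg : ∫ φ in (Real.pi - α)..Real.pi, |Real.cos α + Real.cos φ|
      = -(Real.cos α * α) + Real.sin α := by
    rw [intervalIntegral.integral_congr (g := fun φ => -(Real.cos α + Real.cos φ)),
      intervalIntegral.integral_neg, hprim]
    · simp; ring
    · intro φ hφ
      rw [uIcc_of_le (by linarith)] at hφ
      refine abs_of_nonpos ?_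
      have := Real.cos_le_cos_of_nonneg_of_le_pi (by linarith) hφ.2 hφ.1
      rw [Real.cos_pi_sub] at this
      linarith
  have heven : ∫ φ in (-Real.pi)..0, |Real.cos α + Real.cos φ|
      = ∫ φ in (0 : ℝ)..Real.pi, |Real.cos α + Real.cos φ| := by
    have := intervalIntegral.integral_comp_neg (a := 0) (b := Real.pi)
      (fun φ => |Real.cos α + Real.cos φ|)
    simpa using this.symm
  rw [← intervalIntegral.integral_add_adjacent_intervals (hint _ 0) (hint 0 _), heven,
    ← intervalIntegral.integral_add_adjacent_intervals (hint 0 (Real.pi - α)) (hint _ _), hpos,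
    hneg]
  ring

theorem integral_abs_cos_mul_cos_sub {α : ℝ} (h0 : 0 ≤ α) (hπ : α ≤ Real.pi) :
    ∫ θ in (-Real.pi)..Real.pi, |Real.cos θ * Real.cos (θ - α)|
      = Real.cos α * (Real.pi - 2 * α) + 2 * Real.sin α := by
  have hper : Function.Periodic (fun φ => |Real.cos α + Real.cos φ|) (2 * Real.pi) := fun φ => by
    simp [Real.cos_add_two_pi]
  have hint : ∀ a b : ℝ, IntervalIntegrable (fun φ => |Real.cos α + Real.cos φ|) volume a b :=
    fun a b => Continuous.intervalIntegrable (by fun_prop) a b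
  have h1 : ∀ θ : ℝ, |Real.cos θ * Real.cos (θ - α)|
      = 2⁻¹ * |Real.cos α + Real.cos (2 * θ - α)| := by
    intro θ
    have : Real.cos α + Real.cos (2 * θ - α) = 2 * (Real.cos θ * Real.cos (θ - α)) := by
      rw [add_comm, Real.cos_add_cos]
      ring_nf
    rw [this, abs_mul 2, abs_two]
    ring
  simp_rw [h1]
  rw [intervalIntegral.integral_const_mul, intervalIntegral.integral_comp_mul_sub
    (fun φ => |Real.cos α + Real.cos φ|) two_ne_zero]
  have h2 : ∀ a : ℝ, ∫ φ in a..(a + 2 * Real.pi), |Real.cos α + Real.cos φ|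
      = 2 * (Real.cos α * (Real.pi - 2 * α) + 2 * Real.sin α) := by
    intro a
    rw [hper.intervalIntegral_add_eq a (-Real.pi), ← integral_abs_cos_add_cos h0 hπ]
    congr 1
    ring
  have h3 : ∫ φ in (2 * -Real.pi - α)..(2 * Real.pi - α), |Real.cos α + Real.cos φ|
      = 4 * (Real.cos α * (Real.pi - 2 * α) + 2 * Real.sin α) := by
    rw [← intervalIntegral.integral_add_adjacent_intervals (hint _ (-α)) (hint (-α) _)]
    have e1 : (-α : ℝ) = (2 * -Real.pi - α) + 2 * Real.pi := by ring
    have e2 : (2 * Real.pi - α : ℝ) = -α + 2 * Real.pi := by ring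
    rw [e2, h2 (-α)]
    have h4 := h2 (2 * -Real.pi - α)
    rw [← e1] at h4
    rw [h4]
    ring
  rw [h3, smul_eq_mul]
  ring

/-- The first absolute moment of the product of two standard Gaussian random variables with
correlation `cos α`. -/
theorem lintegral_abs_mul_gaussianReal {α : ℝ} (h0 : 0 ≤ α) (hπ : α ≤ Real.pi) :
    ∫⁻ x, ENNReal.ofReal |x.1 * (Real.cos α * x.1 + Real.sin α * x.2)|
      ∂(gaussianReal 0 1).prod (gaussianReal 0 1)
      = ENNReal.ofReal (1 / Real.pi * (Real.cos α * (Real.pi - 2 * α) + 2 * Real.sin α)) := by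
  have hπ0 := Real.pi_pos
  rw [lintegral_gaussianReal_prod_eq, ← lintegral_comp_polarCoord_symm]
  have hpt : ∀ p ∈ polarCoord.target, ENNReal.ofReal p.1 •
      (ENNReal.ofReal |(polarCoord.symm p).1 * (Real.cos α * (polarCoord.symm p).1
        + Real.sin α * (polarCoord.symm p).2)| *
        (gaussianPDF 0 1 (polarCoord.symm p).1 * gaussianPDF 0 1 (polarCoord.symm p).2))
      = ENNReal.ofReal (1 / (2 * Real.pi) * (p.1 ^ 3 * Real.exp (-p.1 ^ 2 / 2))) *
        ENNReal.ofReal |Real.cos p.2 * Real.cos (p.2 - α)| := by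
    rintro ⟨r, θ⟩ hp
    have hr : 0 < r := hp.1
    have he : Real.exp (-(r * Real.cos θ) ^ 2 / 2) * Real.exp (-(r * Real.sin θ) ^ 2 / 2)
        = Real.exp (-r ^ 2 / 2) := by
      rw [← Real.exp_add]
      congr 1
      linear_combination (-r ^ 2 / 2) * Real.sin_sq_add_cos_sq θ
    have hs : (√(2 * Real.pi))⁻¹ * (√(2 * Real.pi))⁻¹ = 1 / (2 * Real.pi) := by
      rw [← mul_inv, Real.mul_self_sqrt (by positivity), one_div]
    have ha : |r * Real.cos θ * (Real.cos α * (r * Real.cos θ) + Real.sin α * (r * Real.sin θ))|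
        = r ^ 2 * |Real.cos θ * Real.cos (θ - α)| := by
      rw [← abs_of_nonneg (sq_nonneg r), ← abs_mul, Real.cos_sub]
      congr 1
      ring
    simp only [polarCoord_symm_apply, smul_eq_mul, gaussianPDF, ha]
    rw [← ENNReal.ofReal_mul (gaussianPDFReal_nonneg _ _ _), ← ENNReal.ofReal_mul (by positivity),
      ← ENNReal.ofReal_mul hr.le, ← ENNReal.ofReal_mul (by positivity), gaussianPDFReal_std,
      gaussianPDFReal_std, ← hs, ← he]
    congr 1
    ring
  rw [setLIntegral_congr_fun polarCoord.open_target.measurableSet hpt, polarCoord_target,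
    Measure.volume_eq_prod, ← Measure.prod_restrict, lintegral_prod_mul
      (f := fun r : ℝ => ENNReal.ofReal (1 / (2 * Real.pi) * (r ^ 3 * Real.exp (-r ^ 2 / 2))))
      (g := fun θ : ℝ => ENNReal.ofReal |Real.cos θ * Real.cos (θ - α)|)
      (Measurable.aemeasurable (by fun_prop)) (Measurable.aemeasurable (by fun_prop))]
  have hR : ∫⁻ r in Ioi (0 : ℝ), ENNReal.ofReal (1 / (2 * Real.pi) *
      (r ^ 3 * Real.exp (-r ^ 2 / 2))) = ENNReal.ofReal (1 / Real.pi) := by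
    have hI := integral_pow_three_mul_exp_neg_sq_div_two
    rw [← ofReal_integral_eq_lintegral_ofReal, integral_const_mul, hI]
    · congr 1
      field_simp
    · refine Integrable.const_mul ?_ _
      by_contra hni
      rw [integral_undef hni] at hI
      norm_num at hI
    · refine (ae_restrict_mem measurableSet_Ioi).mono fun r hr => ?_
      have : (0 : ℝ) < r := hr
      simp only [Pi.zero_apply]
      positivity
  have hΘ : ∫⁻ θ in Ioo (-Real.pi) Real.pi, ENNReal.ofReal |Real.cos θ * Real.cos (θ - α)|
      = ENNReal.ofReal (Real.cos α * (Real.pi - 2 * α) + 2 * Real.sin α) := by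
    rw [← integral_abs_cos_mul_cos_sub h0 hπ, intervalIntegral.integral_of_le (by linarith),
      integral_Ioc_eq_integral_Ioo, ofReal_integral_eq_lintegral_ofReal]
    · exact (Continuous.integrableOn_Icc (by fun_prop)).mono_set Ioo_subset_Icc_self
    · exact ae_of_all _ fun θ => abs_nonneg _
  rw [hR, hΘ, ← ENNReal.ofReal_mul (by positivity)]

end Moments

section Tilting

theorem ofReal_gaussianPDFReal_eq_integral (x : ℝ) :
    ((gaussianPDFReal 0 1 x : ℝ) : ℂ)
      = ((√(2 * Real.pi))⁻¹ : ℝ) * ∫ y, Complex.exp ((y * x : ℝ) * Complex.I) ∂gaussianReal 0 1 := by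
  have h := charFun_gaussianReal (μ := 0) (v := 1) x
  rw [charFun_apply_real] at h
  have h2 : ∀ y : ℝ, Complex.exp ((y * x : ℝ) * Complex.I)
      = Complex.exp (x * y * Complex.I) := fun y => by push_cast; ring_nf
  simp_rw [h2, h, gaussianPDFReal_std]
  push_cast
  congr 2
  ring

/-- Fourier representation of a Gaussian weight. -/
theorem integral_gaussianPDFReal_mul {Ω : Type*} [MeasurableSpace Ω] {P : Measure Ω}
    [IsFiniteMeasure P] {X : Ω → ℝ} (hX : Measurable X) {H : Ω → ℂ} (hH : Measurable H) {b : ℝ}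
    (hb : ∀ ω, ‖H ω‖ ≤ b) :
    ∫ ω, (gaussianPDFReal 0 1 (X ω) : ℂ) * H ω ∂P = ((√(2 * Real.pi))⁻¹ : ℝ) *
      ∫ y, (∫ ω, Complex.exp ((y * X ω : ℝ) * Complex.I) * H ω ∂P) ∂gaussianReal 0 1 := by
  rw [integral_integral_swap, ← integral_const_mul]
  · refine integral_congr_ae (ae_of_all _ fun ω => ?_)
    simp only
    rw [integral_mul_const, ofReal_gaussianPDFReal_eq_integral]
    ring
  · refine Integrable.of_bound (C := b) (Measurable.aestronglyMeasurable ?_)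
      (ae_of_all _ fun p => ?_)
    · exact Measurable.mul (by fun_prop) (hH.comp measurable_snd)
    · rw [uncurry, norm_mul, Complex.norm_exp_ofReal_mul_I, one_mul]
      exact hb _

theorem integral_exp_neg_sq_gaussianReal {A : ℝ} (hA : 0 < A) (δ Q : ℝ) :
    ∫ y, Real.exp (-(A * (y + δ) ^ 2 + Q - y ^ 2) / 2) ∂gaussianReal 0 1
      = Real.exp (-Q / 2) / √A := by
  rw [integral_gaussianReal_eq_integral_smul one_ne_zero]
  have h1 : ∀ y : ℝ, gaussianPDFReal 0 1 y • Real.exp (-(A * (y + δ) ^ 2 + Q - y ^ 2) / 2)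
      = (√(2 * Real.pi))⁻¹ * Real.exp (-Q / 2) * Real.exp (-(A / 2) * (y + δ) ^ 2) := by
    intro y
    rw [gaussianPDFReal_std, smul_eq_mul, mul_assoc, mul_assoc, ← Real.exp_add, ← Real.exp_add]
    congr 2
    ring
  simp_rw [h1]
  rw [integral_const_mul,
    integral_add_right_eq_self (fun y : ℝ => Real.exp (-(A / 2) * y ^ 2)) δ, integral_gaussian]
  have h2 : Real.pi / (A / 2) = 2 * Real.pi / A := by field_simp
  rw [h2, Real.sqrt_div (by positivity)]
  have h3 : √(2 * Real.pi) ≠ 0 := by positivity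
  field_simp

/-- A one-dimensional Gaussian tilt. -/
theorem integral_gaussianPDFReal_mul_exp {Ω : Type*} [MeasurableSpace Ω] {P : Measure Ω}
    [IsFiniteMeasure P] {X ξ : Ω → ℝ} (hX : Measurable X) (hξ : Measurable ξ) {A δ Q : ℝ}
    (hA : 0 < A)
    (h : ∀ y : ℝ, ∫ ω, Complex.exp ((y * X ω + ξ ω : ℝ) * Complex.I) ∂P
      = Complex.exp (-((A * (y + δ) ^ 2 + Q - y ^ 2 : ℝ) : ℂ) / 2)) :
    ∫ ω, (gaussianPDFReal 0 1 (X ω) : ℂ) * Complex.exp (ξ ω * Complex.I) ∂P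
      = (((√(2 * Real.pi))⁻¹ / √A * Real.exp (-Q / 2) : ℝ) : ℂ) := by
  rw [integral_gaussianPDFReal_mul hX (b := 1) (by fun_prop)
    (fun ω => (Complex.norm_exp_ofReal_mul_I _).le)]
  have h1 : ∀ y : ℝ, ∫ ω, Complex.exp ((y * X ω : ℝ) * Complex.I) * Complex.exp (ξ ω * Complex.I) ∂P
      = ((Real.exp (-(A * (y + δ) ^ 2 + Q - y ^ 2) / 2) : ℝ) : ℂ) := by
    intro y
    rw [Complex.ofReal_exp]
    push_cast
    have := h y
    push_cast at this
    rw [← this]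
    refine integral_congr_ae (ae_of_all _ fun ω => ?_)
    simp only
    rw [← Complex.exp_add]
    congr 1
    ring
  simp_rw [h1]
  rw [integral_complex_ofReal, integral_exp_neg_sq_gaussianReal hA]
  push_cast
  ring

/-- A two-dimensional Gaussian tilt. -/
theorem integral_gaussianPDFReal_mul_mul_exp {Ω : Type*} [MeasurableSpace Ω] {P : Measure Ω}
    [IsFiniteMeasure P] {X₀ X₁ ξ : Ω → ℝ} (hX₀ : Measurable X₀) (hX₁ : Measurable X₁)
    (hξ : Measurable ξ) {A B β δ ε Q : ℝ} (hA : 0 < A) (hB : 0 < B)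
    (h : ∀ y₀ y₁ : ℝ, ∫ ω, Complex.exp ((y₀ * X₀ ω + y₁ * X₁ ω + ξ ω : ℝ) * Complex.I) ∂P
      = Complex.exp (-((A * (y₁ + β * y₀ + δ) ^ 2 + B * (y₀ + ε) ^ 2 + Q - y₀ ^ 2 - y₁ ^ 2 : ℝ) : ℂ)
        / 2)) :
    ∫ ω, ((gaussianPDFReal 0 1 (X₀ ω) * gaussianPDFReal 0 1 (X₁ ω) : ℝ) : ℂ)
      * Complex.exp (ξ ω * Complex.I) ∂P
      = (((2 * Real.pi)⁻¹ / √(A * B) * Real.exp (-Q / 2) : ℝ) : ℂ) := by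
  have hbound : ∀ x : ℝ, gaussianPDFReal 0 1 x ≤ (√(2 * Real.pi))⁻¹ := fun x => by
    rw [gaussianPDFReal_std]
    refine mul_le_of_le_one_right (by positivity) (Real.exp_le_one_iff.2 ?_)
    linarith [sq_nonneg x]
  have h0 : ∀ ω, ((gaussianPDFReal 0 1 (X₀ ω) * gaussianPDFReal 0 1 (X₁ ω) : ℝ) : ℂ)
      * Complex.exp (ξ ω * Complex.I) = (gaussianPDFReal 0 1 (X₀ ω) : ℂ)
        * ((gaussianPDFReal 0 1 (X₁ ω) : ℂ) * Complex.exp (ξ ω * Complex.I)) := fun ω => by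
    push_cast; ring
  simp_rw [h0]
  have hm : Measurable fun ω => gaussianPDFReal 0 1 (X₁ ω) :=
    (measurable_gaussianPDFReal 0 1).comp hX₁
  rw [integral_gaussianPDFReal_mul hX₀ (b := (√(2 * Real.pi))⁻¹) (by fun_prop) (fun ω => by
    rw [norm_mul, Complex.norm_exp_ofReal_mul_I, mul_one, Complex.norm_real, Real.norm_eq_abs,
      abs_of_nonneg (gaussianPDFReal_nonneg _ _ _)]
    exact hbound _)]
  have h1 : ∀ y₀ : ℝ, ∫ ω, Complex.exp ((y₀ * X₀ ω : ℝ) * Complex.I)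
        * ((gaussianPDFReal 0 1 (X₁ ω) : ℂ) * Complex.exp (ξ ω * Complex.I)) ∂P
      = (((√(2 * Real.pi))⁻¹ / √A * Real.exp (-(B * (y₀ + ε) ^ 2 + Q - y₀ ^ 2) / 2) : ℝ) : ℂ) := by
    intro y₀
    rw [← integral_gaussianPDFReal_mul_exp (P := P) (X := X₁) (ξ := fun ω => y₀ * X₀ ω + ξ ω)
      (δ := β * y₀ + δ) hX₁ (by fun_prop) hA]
    · refine integral_congr_ae (ae_of_all _ fun ω => ?_)
      simp only
      push_cast
      rw [add_mul, Complex.exp_add]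
      ring
    · intro y₁
      convert h y₀ y₁ using 2
      · ext ω
        push_cast
        ring_nf
      · push_cast
        ring
  simp_rw [h1]
  rw [integral_complex_ofReal, integral_const_mul, integral_exp_neg_sq_gaussianReal hB,
    Real.sqrt_mul hA.le, ← Complex.ofReal_mul]
  have hs : (2 * Real.pi)⁻¹ = (√(2 * Real.pi))⁻¹ * (√(2 * Real.pi))⁻¹ := by
    rw [← mul_inv, Real.mul_self_sqrt (by positivity)]
  rw [hs]
  congr 1
  field_simp

/-- The absolute moment of a Gaussian random variable, the Gaussian law being given through the
Fourier transform and up to a constant. -/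
theorem lintegral_abs_of_fourier {Ω : Type*} [MeasurableSpace Ω] {P : Measure Ω}
    [IsFiniteMeasure P] {f : Ω → ℝ≥0∞} (hf : Measurable f) (hfP : ∫⁻ ω, f ω ∂P ≠ ∞)
    {p : Ω → ℝ} (hp : Measurable p) {C u : ℝ} (hC : 0 ≤ C) (hf' : ∀ ω, f ω < ∞)
    (h : ∀ l : ℝ, ∫ ω, ((f ω).toReal : ℂ) * Complex.exp ((l * p ω : ℝ) * Complex.I) ∂P
      = ((C * Real.exp (-(u * l) ^ 2 / 2) : ℝ) : ℂ)) :
    ∫⁻ ω, ENNReal.ofReal |p ω| * f ω ∂P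
      = ENNReal.ofReal (C * (|u| * (2 / √(2 * Real.pi)))) := by
  have hfin : IsFiniteMeasure (P.withDensity f) := isFiniteMeasure_withDensity hfP
  have hmap : (P.withDensity f).map p
      = ENNReal.ofReal C • (gaussianReal 0 1).map (fun x => u * x) := by
    have : IsFiniteMeasure (ENNReal.ofReal C • (gaussianReal 0 1).map (fun x => u * x)) := by
      have := Measure.isFiniteMeasure_map (gaussianReal 0 1) (fun x => u * x)
      exact Measure.smul_finite _ ENNReal.ofReal_ne_top
    refine Measure.ext_of_charFun (funext fun l => ?_)
    rw [charFun_apply_real, charFun_apply_real, integral_smul_measure,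
      integral_map hp.aemeasurable (by fun_prop), integral_map (by fun_prop) (by fun_prop),
      integral_withDensity_eq_integral_toReal_smul hf (ae_of_all _ hf')]
    have h2 := charFun_gaussianReal (μ := 0) (v := 1) (u * l)
    rw [charFun_apply_real] at h2
    have h3 : ∀ x : ℝ, Complex.exp (l * ((u * x : ℝ) : ℂ) * Complex.I)
      = Complex.exp ((u * l : ℝ) * x * Complex.I) := fun x => by push_cast; ring_nf
    simp_rw [h3, h2]
    have h1 := h l
    push_cast at h1
    rw [ENNReal.toReal_ofReal hC]
    simp_rw [Complex.real_smul]
    rw [h1]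
    push_cast
    ring_nf
  have key : ∫⁻ x, ENNReal.ofReal |x| ∂(P.withDensity f).map p
      = ENNReal.ofReal (C * (|u| * (2 / √(2 * Real.pi)))) := by
    rw [hmap, lintegral_smul_measure, lintegral_map (by fun_prop) (by fun_prop)]
    simp_rw [abs_mul, ENNReal.ofReal_mul (abs_nonneg u)]
    rw [lintegral_const_mul _ (by fun_prop), lintegral_abs_gaussianReal, smul_eq_mul,
      ← ENNReal.ofReal_mul (abs_nonneg u), ← ENNReal.ofReal_mul hC]
  rw [← key, lintegral_map (by fun_prop) hp, lintegral_withDensity_eq_lintegral_mul _ hf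
    (by fun_prop)]
  simp [mul_comm]

/-- The absolute moment of a product of two Gaussian random variables, the Gaussian law being given
through the Fourier transform and up to a constant. -/
theorem lintegral_abs_mul_of_fourier {Ω : Type*} [MeasurableSpace Ω] {P : Measure Ω}
    [IsFiniteMeasure P] {f : Ω → ℝ≥0∞} (hf : Measurable f) (hfP : ∫⁻ ω, f ω ∂P ≠ ∞)
    (hf' : ∀ ω, f ω < ∞) {p q : Ω → ℝ} (hp : Measurable p) (hq : Measurable q) {C u v α : ℝ}
    (hC : 0 ≤ C) (h0 : 0 ≤ α) (hπ : α ≤ Real.pi)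
    (h : ∀ l m : ℝ, ∫ ω, ((f ω).toReal : ℂ) *
      Complex.exp ((l * p ω + m * q ω : ℝ) * Complex.I) ∂P
      = ((C * Real.exp (-((u * l) ^ 2 + (v * m) ^ 2 + 2 * (u * v * Real.cos α) * l * m) / 2) : ℝ)
        : ℂ)) :
    ∫⁻ ω, ENNReal.ofReal |p ω * q ω| * f ω ∂P = ENNReal.ofReal
      (C * (|u * v| * (1 / Real.pi * (Real.cos α * (Real.pi - 2 * α) + 2 * Real.sin α)))) := by
  have hfin : IsFiniteMeasure (P.withDensity f) := isFiniteMeasure_withDensity hfP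
  set T : ℝ × ℝ → ℝ × ℝ := fun x => (u * x.1, v * (Real.cos α * x.1 + Real.sin α * x.2)) with hT
  have hTm : Measurable T := by fun_prop
  set γ := gaussianReal 0 1
  have hpq : Measurable fun ω => (p ω, q ω) := hp.prodMk hq
  have hmap : (P.withDensity f).map (fun ω => (p ω, q ω))
      = ENNReal.ofReal C • (γ.prod γ).map T := by
    have : IsFiniteMeasure (ENNReal.ofReal C • (γ.prod γ).map T) := by
      have := Measure.isFiniteMeasure_map (γ.prod γ) T
      exact Measure.smul_finite _ ENNReal.ofReal_ne_top
    refine Measure.ext_of_charFunDual (funext fun L => ?_)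
    obtain ⟨l, m, hL⟩ : ∃ l m : ℝ, ∀ x : ℝ × ℝ, L x = l * x.1 + m * x.2 := by
      refine ⟨L (1, 0), L (0, 1), fun x => ?_⟩
      have : x = x.1 • ((1 : ℝ), (0 : ℝ)) + x.2 • ((0 : ℝ), (1 : ℝ)) := by ext <;> simp
      conv_lhs => rw [this]
      rw [map_add, map_smul, map_smul, smul_eq_mul, smul_eq_mul]
      ring
    rw [charFunDual_apply, charFunDual_apply, integral_smul_measure,
      integral_map hpq.aemeasurable (by fun_prop), integral_map hTm.aemeasurable (by fun_prop),
      integral_withDensity_eq_integral_toReal_smul hf (ae_of_all _ hf')]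
    simp_rw [hL, Complex.real_smul]
    rw [h l m, ENNReal.toReal_ofReal hC]
    have h3 : ∀ x : ℝ × ℝ, Complex.exp (((l * (T x).1 + m * (T x).2 : ℝ) : ℂ) * Complex.I)
        = Complex.exp (((u * l + v * m * Real.cos α : ℝ) : ℂ) * x.1 * Complex.I)
          * Complex.exp (((v * m * Real.sin α : ℝ) : ℂ) * x.2 * Complex.I) := fun x => by
      rw [← Complex.exp_add]
      simp only [hT]
      push_cast
      ring_nf
    simp_rw [h3]
    rw [integral_prod_mul (μ := γ) (ν := γ)
      (fun x : ℝ => Complex.exp (((u * l + v * m * Real.cos α : ℝ) : ℂ) * x * Complex.I))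
      (fun x : ℝ => Complex.exp (((v * m * Real.sin α : ℝ) : ℂ) * x * Complex.I)),
      ← charFun_apply_real, ← charFun_apply_real, charFun_gaussianReal, charFun_gaussianReal,
      ← Complex.exp_add, Complex.ofReal_mul, Complex.ofReal_exp]
    congr 2
    have hsc := Real.sin_sq_add_cos_sq α
    have : -((u * l) ^ 2 + (v * m) ^ 2 + 2 * (u * v * Real.cos α) * l * m) / 2
        = -(u * l + v * m * Real.cos α) ^ 2 / 2 - (v * m * Real.sin α) ^ 2 / 2 := by
      linear_combination (v ^ 2 * m ^ 2 / 2) * hsc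
    rw [this]
    push_cast
    simp
    ring
  have key : ∫⁻ x, ENNReal.ofReal |x.1 * x.2| ∂(P.withDensity f).map (fun ω => (p ω, q ω))
      = ENNReal.ofReal
      (C * (|u * v| * (1 / Real.pi * (Real.cos α * (Real.pi - 2 * α) + 2 * Real.sin α)))) := by
    rw [hmap, lintegral_smul_measure, lintegral_map (by fun_prop) hTm]
    have h4 : ∀ x : ℝ × ℝ, ENNReal.ofReal |(T x).1 * (T x).2| = ENNReal.ofReal |u * v| *
        ENNReal.ofReal |x.1 * (Real.cos α * x.1 + Real.sin α * x.2)| := fun x => by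
      rw [← ENNReal.ofReal_mul (abs_nonneg _), ← abs_mul]
      simp only [hT]
      ring_nf
    simp_rw [h4]
    rw [lintegral_const_mul _ (by fun_prop), lintegral_abs_mul_gaussianReal h0 hπ, smul_eq_mul,
      ← ENNReal.ofReal_mul (abs_nonneg _), ← ENNReal.ofReal_mul hC]
  rw [← key, lintegral_map (by fun_prop) hpq, lintegral_withDensity_eq_lintegral_mul _ hf
    (by fun_prop)]
  simp [mul_comm]

end Tilting

section QuadraticForm

theorem hasSum_of_eq {f g : ℕ → ℝ} {a b : ℝ} (h : HasSum f a) (hfg : ∀ n, g n = f n) (hab : b = a) :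
    HasSum g b := by
  rwa [funext hfg, hab]

theorem hasSum_sq_mul_pow {r : ℝ} (hr : |r| < 1) :
    HasSum (fun k : ℕ => (k : ℝ) ^ 2 * r ^ k) (r * (1 + r) / (1 - r) ^ 3) := by
  have hr' : ‖r‖ < 1 := hr
  have h1 : 1 - r ≠ 0 := by linarith [(abs_lt.1 hr).2]
  have h := (((hasSum_choose_mul_geometric_of_norm_lt_one 2 hr').mul_left 2).sub
    ((hasSum_coe_mul_geometric_of_norm_lt_one hr').mul_left 3)).sub
    ((hasSum_geometric_of_norm_lt_one hr').mul_left 2)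
  refine hasSum_of_eq h (fun k => ?_) ?_
  · have h2 : ((Nat.choose (k + 2) 2 : ℕ) : ℝ) = (k + 2) * (k + 1) / 2 := by
      rw [Nat.cast_choose_two]
      push_cast
      ring
    rw [h2]
    ring
  · field_simp
    ring

variable {x y : ℝ}

theorem abs_mul_lt_one (hx : |x| < 1) (hy : |y| < 1) : |x * y| < 1 := by
  rw [abs_mul]
  exact mul_lt_one_of_nonneg_of_lt_one_left (abs_nonneg _) hx hy.le

theorem hasSum_kernel (hx : |x| < 1) (hy : |y| < 1) :
    HasSum (fun j : ℕ => x ^ j * y ^ j) (1 / (1 - x * y)) := by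
  have h := hasSum_geometric_of_norm_lt_one (ξ := x * y) (abs_mul_lt_one hx hy)
  rw [one_div]
  exact h.congr_fun fun j => (mul_pow x y j).symm

theorem hasSum_kernel_deriv (hx : |x| < 1) (hy : |y| < 1) :
    HasSum (fun j : ℕ => x ^ j * (j * y ^ (j - 1))) (x / (1 - x * y) ^ 2) := by
  have hxy := abs_mul_lt_one hx hy
  have h1 : 1 - x * y ≠ 0 := by linarith [(abs_lt.1 hxy).2]
  rw [← hasSum_nat_add_iff' 1]
  have h := ((hasSum_coe_mul_geometric_of_norm_lt_one (r := x * y) hxy).add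
    (hasSum_geometric_of_norm_lt_one (ξ := x * y) hxy)).mul_left x
  refine hasSum_of_eq h (fun j => ?_) ?_
  · push_cast
    rw [mul_pow]
    ring
  · simp
    field_simp
    ring

theorem hasSum_kernel_deriv_deriv (hx : |x| < 1) (hy : |y| < 1) :
    HasSum (fun j : ℕ => (j * x ^ (j - 1)) * (j * y ^ (j - 1)))
      ((1 + x * y) / (1 - x * y) ^ 3) := by
  have hxy := abs_mul_lt_one hx hy
  have h1 : 1 - x * y ≠ 0 := by linarith [(abs_lt.1 hxy).2]
  rw [← hasSum_nat_add_iff' 1]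
  have h := ((hasSum_sq_mul_pow hxy).add
    ((hasSum_coe_mul_geometric_of_norm_lt_one (r := x * y) hxy).mul_left 2)).add
    (hasSum_geometric_of_norm_lt_one (ξ := x * y) hxy)
  refine hasSum_of_eq h (fun j => ?_) ?_
  · push_cast
    rw [mul_pow]
    ring
  · simp
    field_simp
    ring

/-- The variance of `a f(s) + b f(t) + l f'(s) + m f'(t)`. -/
noncomputable def covForm (s t a b l m : ℝ) : ℝ :=
  a ^ 2 / (1 - s * s) + b ^ 2 / (1 - t * t) + 2 * a * b / (1 - s * t)
    + l ^ 2 * (1 + s * s) / (1 - s * s) ^ 3 + m ^ 2 * (1 + t * t) / (1 - t * t) ^ 3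
    + 2 * l * m * (1 + s * t) / (1 - s * t) ^ 3
    + 2 * a * l * s / (1 - s * s) ^ 2 + 2 * a * m * s / (1 - s * t) ^ 2
    + 2 * b * l * t / (1 - s * t) ^ 2 + 2 * b * m * t / (1 - t * t) ^ 2

theorem hasSum_covForm {s t : ℝ} (hs : |s| < 1) (ht : |t| < 1) (a b l m : ℝ) :
    HasSum (fun j : ℕ => (a * s ^ j + b * t ^ j + l * (j * s ^ (j - 1)) + m * (j * t ^ (j - 1))) ^ 2)
      (covForm s t a b l m) := by
  have h := ((((((((((hasSum_kernel hs hs).mul_left (a ^ 2)).add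
    ((hasSum_kernel ht ht).mul_left (b ^ 2))).add
    ((hasSum_kernel hs ht).mul_left (2 * a * b))).add
    ((hasSum_kernel_deriv_deriv hs hs).mul_left (l ^ 2))).add
    ((hasSum_kernel_deriv_deriv ht ht).mul_left (m ^ 2))).add
    ((hasSum_kernel_deriv_deriv hs ht).mul_left (2 * l * m))).add
    ((hasSum_kernel_deriv hs hs).mul_left (2 * a * l))).add
    ((hasSum_kernel_deriv hs ht).mul_left (2 * a * m))).add
    ((hasSum_kernel_deriv ht hs).mul_left (2 * b * l))).add
    ((hasSum_kernel_deriv ht ht).mul_left (2 * b * m))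
  refine hasSum_of_eq h (fun j => by ring) ?_
  rw [mul_comm t s] at *
  simp only [covForm]
  ring

theorem PolyGrowth.hasSum_tail {c : ℕ → ℝ} (hc : PolyGrowth c) (n : ℕ) {t : ℝ} (ht : |t| < 1) :
    HasSum (fun k => c k * t ^ (k + n)) (tail n c t) := by
  refine ((hc.hasSum ht).mul_left (t ^ n)).congr_fun fun k => ?_
  ring

theorem PolyGrowth.hasSum_tailDeriv {c : ℕ → ℝ} (hc : PolyGrowth c) (n : ℕ) {t : ℝ}
    (ht : |t| < 1) :
    HasSum (fun k : ℕ => c k * (((k + (n + 1) : ℕ) : ℝ) * t ^ (k + (n + 1) - 1)))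
      (tailDeriv (n + 1) c t) := by
  have h1 : HasSum (fun k : ℕ => c k * (k * t ^ (k - 1))) (seriesSum (GaussianPowerSeries.derivCoeff c) t) := by
    rw [← hasSum_nat_add_iff' 1]
    simp only [Finset.range_one, Finset.sum_singleton, CharP.cast_eq_zero, zero_mul, mul_zero,
      sub_zero]
    refine (hc.derivCoeff.hasSum ht).congr_fun fun k => ?_
    rw [GaussianPowerSeries.derivCoeff, Nat.add_sub_cancel]
    push_cast
    ring
  refine (((hc.hasSum ht).mul_left (((n + 1 : ℕ) : ℝ) * t ^ (n + 1 - 1))).add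
    (h1.mul_left (t ^ (n + 1)))).congr_fun fun k => ?_
  rw [← add_assoc, Nat.add_sub_cancel, Nat.add_sub_cancel]
  cases k with
  | zero => simp; ring
  | succ k =>
    rw [Nat.add_sub_cancel]
    push_cast
    ring

/-- The characteristic function of linear combinations of the values and of the derivatives of
`tail n`. -/
theorem integral_exp_tail (n : ℕ) {s t : ℝ} (hs : |s| < 1) (ht : |t| < 1) (a b l m : ℝ) :
    ∫ c, Complex.exp ((a * tail (n + 1) c s + b * tail (n + 1) c t + l * tailDeriv (n + 1) c s
      + m * tailDeriv (n + 1) c t : ℝ) * Complex.I) ∂coeffLaw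
      = Complex.exp (-((covForm s t a b l m - ∑ j ∈ Finset.range (n + 1),
        (a * s ^ j + b * t ^ j + l * (j * s ^ (j - 1)) + m * (j * t ^ (j - 1))) ^ 2 : ℝ) : ℂ) / 2) := by
  refine integral_exp_linear ((hasSum_nat_add_iff' (n + 1)).2 (hasSum_covForm hs ht a b l m)) ?_
  filter_upwards [ae_polyGrowth] with c hc
  refine (((((hc.hasSum_tail (n + 1) hs).mul_left a).add ((hc.hasSum_tail (n + 1) ht).mul_left b)).add
    ((hc.hasSum_tailDeriv n hs).mul_left l)).add
    ((hc.hasSum_tailDeriv n ht).mul_left m)).congr_fun fun k => ?_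
  ring

end QuadraticForm

section OnePoint

theorem gaussianPDF_neg (x : ℝ) : gaussianPDF 0 1 (-x) = gaussianPDF 0 1 x := by
  simp [gaussianPDF, gaussianPDFReal_std]

theorem gaussianPDF_le_one (x : ℝ) : gaussianPDF 0 1 x ≤ 1 := by
  rw [gaussianPDF, gaussianPDFReal_std, ENNReal.ofReal_le_one]
  refine mul_le_one₀ (inv_le_one_of_one_le₀ ?_) (Real.exp_nonneg _) (Real.exp_le_one_iff.2 ?_)
  · rw [Real.one_le_sqrt]
    linarith [Real.two_le_pi]
  · linarith [sq_nonneg x]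

/-- The one-point correlation function. -/
noncomputable def density (t : ℝ) : ℝ := 1 / (Real.pi * (1 - t ^ 2))

theorem lintegral_one_point {t : ℝ} (ht : |t| < 1) :
    ∫⁻ c, ENNReal.ofReal |tailDeriv 1 c t| * gaussianPDF 0 1 (-tail 1 c t) ∂coeffLaw
      = ENNReal.ofReal (density t) := by
  simp_rw [gaussianPDF_neg]
  have hd : 0 < 1 - t * t := by
    have := (abs_lt.1 (abs_mul_lt_one ht ht)).2
    linarith
  have hmt : Measurable fun c => tail 1 c t :=
    (measurable_tail 1).comp (measurable_id.prodMk measurable_const)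
  have hmd : Measurable fun c => tailDeriv 1 c t :=
    (measurable_tailDeriv 1).comp (measurable_id.prodMk measurable_const)
  rw [lintegral_abs_of_fourier (f := fun c => gaussianPDF 0 1 (tail 1 c t))
    (C := (√(2 * Real.pi))⁻¹ / √(1 / (1 - t * t)))
    (u := √(1 / (1 - t * t) ^ 3)) ((measurable_gaussianPDF 0 1).comp hmt) ?_ hmd (by positivity)
    (fun c => gaussianPDF_lt_top)]
  · congr 1
    have h1 : √(1 / (1 - t * t) ^ 3) = 1 / (1 - t * t) * √(1 / (1 - t * t)) := by
      rw [← Real.sqrt_sq (by positivity : 0 ≤ 1 / (1 - t * t)), ← Real.sqrt_mul (by positivity),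
        Real.sqrt_sq (by positivity)]
      congr 1
      field_simp
    have h2 : √(1 / (1 - t * t)) ≠ 0 := by positivity
    have h3 : √(2 * Real.pi) ≠ 0 := by positivity
    have h4 : √(2 * Real.pi) ^ 2 = 2 * Real.pi := Real.sq_sqrt (by positivity)
    rw [abs_of_nonneg (Real.sqrt_nonneg _), h1, density]
    have h5 : 1 - t ^ 2 ≠ 0 := by rw [sq]; exact hd.ne'
    have h6 : (√(2 * Real.pi))⁻¹ / √(1 / (1 - t * t)) *
        (1 / (1 - t * t) * √(1 / (1 - t * t)) * (2 / √(2 * Real.pi)))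
        = 2 / ((1 - t * t) * √(2 * Real.pi) ^ 2) := by
      generalize √(1 / (1 - t * t)) = A at *
      field_simp
    rw [h6, h4, sq]
    field_simp
  · intro l
    have h := integral_gaussianPDFReal_mul_exp (P := coeffLaw) (X := fun c => tail 1 c t)
      (ξ := fun c => l * tailDeriv 1 c t) hmt (by fun_prop) (A := 1 / (1 - t * t))
      (δ := l * t / (1 - t * t)) (Q := l ^ 2 / (1 - t * t) ^ 3) (by positivity) (fun y => ?_)
    · refine Eq.trans ?_ (h.trans ?_)
      · simp_rw [toReal_gaussianPDF]
      · congr 3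
        rw [mul_pow, Real.sq_sqrt (by positivity)]
        ring
    · have h := integral_exp_tail 0 ht ht y 0 l 0
      simp only [zero_mul, add_zero, zero_add] at h
      have h2 : covForm t t y 0 l 0 - ∑ j ∈ Finset.range 1, (y * t ^ j + l * (j * t ^ (j - 1))) ^ 2
          = 1 / (1 - t * t) * (y + l * t / (1 - t * t)) ^ 2 + l ^ 2 / (1 - t * t) ^ 3 - y ^ 2 := by
        simp only [covForm, Finset.range_one, Finset.sum_singleton, pow_zero, CharP.cast_eq_zero]
        have h3 : 1 - t ^ 2 ≠ 0 := by rw [sq]; exact hd.ne'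
        field_simp
        ring
      rw [h, h2]
  · refine ne_of_lt (lt_of_le_of_lt (lintegral_mono fun c => gaussianPDF_le_one _) ?_)
    simp

end OnePoint

section TwoPoint

/-- Regression of the derivatives on the values at two points. -/
theorem covForm_eq {s t : ℝ} (hs : 0 < 1 - s * s) (ht : 0 < 1 - t * t) (hst : 0 < 1 - s * t)
    (hne : t - s ≠ 0) (a b l m : ℝ) {w₁ w₂ : ℝ}
    (hw₁ : w₁ = a + l * (s / (1 - s * s) - (1 - t * t) / ((1 - s * t) * (t - s)))
      + m * (-(1 - s * s) / ((1 - t * t) * (t - s))))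
    (hw₂ : w₂ = b + l * ((1 - t * t) / ((1 - s * s) * (t - s)))
      + m * (t / (1 - t * t) + (1 - s * s) / ((1 - s * t) * (t - s)))) :
    covForm s t a b l m = w₁ ^ 2 / (1 - s * s) + w₂ ^ 2 / (1 - t * t) + 2 * w₁ * w₂ / (1 - s * t)
      + ((t - s) ^ 2 * l ^ 2 / ((1 - s * t) ^ 2 * (1 - s * s) ^ 3)
        + (t - s) ^ 2 * m ^ 2 / ((1 - s * t) ^ 2 * (1 - t * t) ^ 3)
        - 2 * l * m * (t - s) ^ 2 / ((1 - s * t) ^ 3 * (1 - s * s) * (1 - t * t))) := by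
  have hs' : 1 - s ^ 2 ≠ 0 := by rw [sq]; exact hs.ne'
  have ht' : 1 - t ^ 2 ≠ 0 := by rw [sq]; exact ht.ne'
  obtain ⟨p, hp⟩ : ∃ p, s / (1 - s * s) - (1 - t * t) / ((1 - s * t) * (t - s)) = p := ⟨_, rfl⟩
  obtain ⟨q, hq⟩ : ∃ q, (1 - t * t) / ((1 - s * s) * (t - s)) = q := ⟨_, rfl⟩
  obtain ⟨u, hu⟩ : ∃ u, -(1 - s * s) / ((1 - t * t) * (t - s)) = u := ⟨_, rfl⟩
  obtain ⟨v, hv⟩ : ∃ v, t / (1 - t * t) + (1 - s * s) / ((1 - s * t) * (t - s)) = v := ⟨_, rfl⟩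
  have h1 : p / (1 - s * s) + q / (1 - s * t) = s / (1 - s * s) ^ 2 := by
    rw [← hp, ← hq]; field_simp; ring
  have h2 : p / (1 - s * t) + q / (1 - t * t) = t / (1 - s * t) ^ 2 := by
    rw [← hp, ← hq]; field_simp; ring
  have h3 : u / (1 - s * s) + v / (1 - s * t) = s / (1 - s * t) ^ 2 := by
    rw [← hu, ← hv]; field_simp; ring
  have h4 : u / (1 - s * t) + v / (1 - t * t) = t / (1 - t * t) ^ 2 := by
    rw [← hu, ← hv]; field_simp; ring
  have h5 : p * s / (1 - s * s) ^ 2 + q * t / (1 - s * t) ^ 2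
      + (t - s) ^ 2 / ((1 - s * t) ^ 2 * (1 - s * s) ^ 3) = (1 + s * s) / (1 - s * s) ^ 3 := by
    rw [← hp, ← hq]; field_simp; ring
  have h6 : u * s / (1 - s * t) ^ 2 + v * t / (1 - t * t) ^ 2
      + (t - s) ^ 2 / ((1 - s * t) ^ 2 * (1 - t * t) ^ 3) = (1 + t * t) / (1 - t * t) ^ 3 := by
    rw [← hu, ← hv]; field_simp; ring
  have h7 : p * s / (1 - s * t) ^ 2 + q * t / (1 - t * t) ^ 2
      - (t - s) ^ 2 / ((1 - s * t) ^ 3 * (1 - s * s) * (1 - t * t))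
      = (1 + s * t) / (1 - s * t) ^ 3 := by
    rw [← hp, ← hq]; field_simp; ring
  rw [hp, hu] at hw₁
  rw [hq, hv] at hw₂
  rw [hw₁, hw₂]
  clear hp hq hu hv hw₁ hw₂ hs' ht'
  unfold covForm
  generalize s * s = s₂ at *
  generalize t * t = t₂ at *
  generalize s * t = st at *
  generalize (t - s) ^ 2 = D at *
  generalize 1 - s₂ = S at *
  generalize 1 - t₂ = T at *
  generalize 1 - st = K at *
  linear_combination (-(2 * a * l)) * h1 - 2 * a * m * h3 - 2 * b * l * h2 - 2 * b * m * h4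
    - l ^ 2 * (p * h1 + q * h2 + h5) - m ^ 2 * (u * h3 + v * h4 + h6)
    - 2 * l * m * (p * h3 + q * h4 + h7)

/-- Completing the square in a binary quadratic form. -/
theorem gram_eq {S T K D : ℝ} (hS : 0 < S) (hT : 0 < T) (hK : 0 < K) (h : S * T = K ^ 2 - D ^ 2)
    (hA : 0 < 1 / S + 1 / T - 2 / K) (w₁ w₂ : ℝ) :
    w₁ ^ 2 / S + w₂ ^ 2 / T + 2 * w₁ * w₂ / K
      = (1 / S + 1 / T - 2 / K) * (w₂ - (1 / S - 1 / K) / (1 / S + 1 / T - 2 / K) * (w₁ + w₂)) ^ 2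
        + D ^ 2 / (S * T * K ^ 2) / (1 / S + 1 / T - 2 / K) * (w₁ + w₂) ^ 2 := by
  have hdet : D ^ 2 / (S * T * K ^ 2) = 1 / S * (1 / T) - 1 / K * (1 / K) := by
    rw [show D ^ 2 = K ^ 2 - S * T by linarith]
    field_simp
  rw [hdet]
  have e1 : w₁ ^ 2 / S + w₂ ^ 2 / T + 2 * w₁ * w₂ / K
      = 1 / S * w₁ ^ 2 + 1 / T * w₂ ^ 2 + 2 * w₁ * w₂ * (1 / K) := by ring
  have e2 : 2 / K = 2 * (1 / K) := by ring
  rw [e1]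
  rw [e2] at hA ⊢
  generalize 1 / S = x at *
  generalize 1 / T = y at *
  generalize 1 / K = z at *
  have hA' := hA.ne'
  field_simp
  ring

theorem gram_pos {s t : ℝ} (hs : 0 < 1 - s * s) (ht : 0 < 1 - t * t) (hst : 0 < 1 - s * t)
    (hne : t - s ≠ 0) : 0 < 1 / (1 - s * s) + 1 / (1 - t * t) - 2 / (1 - s * t) := by
  have h : 1 / (1 - s * s) + 1 / (1 - t * t) - 2 / (1 - s * t)
      = (t - s) ^ 2 * (1 + s * t) / ((1 - s * s) * (1 - t * t) * (1 - s * t)) := by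
    have hs' : 1 - s ^ 2 ≠ 0 := by rw [sq]; exact hs.ne'
    have ht' : 1 - t ^ 2 ≠ 0 := by rw [sq]; exact ht.ne'
    field_simp
    ring
  rw [h]
  have : 0 < 1 + s * t := by nlinarith [sq_nonneg (s + t)]
  positivity

/-- The normalized two-point correlation in terms of the pseudo-hyperbolic distance. -/
noncomputable def pairCorr (x : ℝ) : ℝ := x ^ 2 + x * √(1 - x ^ 2) * Real.arccos x

/-- The pseudo-hyperbolic distance. -/
noncomputable def hypDist (s t : ℝ) : ℝ := |(t - s) / (1 - s * t)|

theorem exponent_eq {s t : ℝ} (hs : 0 < 1 - s * s) (ht : 0 < 1 - t * t) (hst : 0 < 1 - s * t)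
    (hne : t - s ≠ 0) (l m : ℝ) : ∃ A B β δ ε : ℝ, 0 < A ∧ 0 < B ∧
      A * B = 1 / ((1 - s * s) * (1 - t * t) * (1 - s * t) ^ 2) ∧
      ∀ y₀ y₁ : ℝ, covForm s t (-y₀ + (y₁ - s * y₀ + l + m) / (t - s))
        (-(y₁ - s * y₀ + l + m) / (t - s)) l m
        = A * (y₁ + β * y₀ + δ) ^ 2 + B * (y₀ + ε) ^ 2
        + ((t - s) ^ 2 * l ^ 2 / ((1 - s * t) ^ 2 * (1 - s * s) ^ 3)
        + (t - s) ^ 2 * m ^ 2 / ((1 - s * t) ^ 2 * (1 - t * t) ^ 3)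
        - 2 * l * m * (t - s) ^ 2 / ((1 - s * t) ^ 3 * (1 - s * s) * (1 - t * t))) := by
  have hA := gram_pos hs ht hst hne
  have hkey : (1 - s * s) * (1 - t * t) = (1 - s * t) ^ 2 - (t - s) ^ 2 := by ring
  set A' := 1 / (1 - s * s) + 1 / (1 - t * t) - 2 / (1 - s * t) with hA'
  set r := (1 / (1 - s * s) - 1 / (1 - s * t)) / A' with hr
  set p := s / (1 - s * s) - (1 - t * t) / ((1 - s * t) * (t - s)) with hp
  set q := (1 - t * t) / ((1 - s * s) * (t - s)) with hq
  set u := -(1 - s * s) / ((1 - t * t) * (t - s)) with hu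
  set v := t / (1 - t * t) + (1 - s * s) / ((1 - s * t) * (t - s)) with hv
  set ε := -(l * (p + q) + m * (u + v)) with hε
  refine ⟨A' / (t - s) ^ 2, (t - s) ^ 2 / ((1 - s * s) * (1 - t * t) * (1 - s * t) ^ 2) / A',
    -s - r * (t - s), (l + m) - (t - s) * (l * q + m * v + r * ε), ε, by positivity, by positivity,
    by field_simp, fun y₀ y₁ => ?_⟩
  rw [covForm_eq hs ht hst hne _ _ l m rfl rfl, ← hp, ← hq, ← hu, ← hv,
    gram_eq hs ht hst hkey hA, ← hA', ← hr]
  clear_value r A' p q u v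
  congr 1
  generalize 1 - s * s = S at *
  generalize 1 - t * t = T at *
  generalize 1 - s * t = K at *
  obtain ⟨D, hD⟩ : ∃ D, t - s = D := ⟨_, rfl⟩
  rw [hD] at hne ⊢
  rw [hε]
  field_simp
  ring

theorem lintegral_two_point {s t : ℝ} (hs : |s| < 1) (ht : |t| < 1) (hne : s ≠ t) :
    ∫⁻ c, ENNReal.ofReal |derivProd c (s, t) / (t - s)| *
        (gaussianPDF 0 1 (twoZeros c (s, t)).1 * gaussianPDF 0 1 (twoZeros c (s, t)).2) ∂coeffLaw
      = ENNReal.ofReal (density s * density t * pairCorr (hypDist s t)) := by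
  have hS : 0 < 1 - s * s := by linarith [(abs_lt.1 (abs_mul_lt_one hs hs)).2]
  have hT : 0 < 1 - t * t := by linarith [(abs_lt.1 (abs_mul_lt_one ht ht)).2]
  have hK : 0 < 1 - s * t := by linarith [(abs_lt.1 (abs_mul_lt_one hs ht)).2]
  have hD : t - s ≠ 0 := sub_ne_zero.2 hne.symm
  have hkey : (1 - s * s) * (1 - t * t) = (1 - s * t) ^ 2 - (t - s) ^ 2 := by ring
  have hmt : ∀ x, Measurable fun c => tail 2 c x := fun x =>
    (measurable_tail 2).comp (measurable_id.prodMk measurable_const)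
  have hmd : ∀ x, Measurable fun c => tailDeriv 2 c x := fun x =>
    (measurable_tailDeriv 2).comp (measurable_id.prodMk measurable_const)
  have hmz : Measurable fun c => twoZeros c (s, t) :=
    measurable_twoZeros.comp (measurable_id.prodMk measurable_const)
  have hms : Measurable fun c => slope c (s, t) :=
    measurable_slope.comp (measurable_id.prodMk measurable_const)
  set f : (ℕ → ℝ) → ℝ≥0∞ := fun c =>
    gaussianPDF 0 1 (twoZeros c (s, t)).1 * gaussianPDF 0 1 (twoZeros c (s, t)).2 with hf
  have hfm : Measurable f := ((measurable_gaussianPDF 0 1).comp hmz.fst).mul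
    ((measurable_gaussianPDF 0 1).comp hmz.snd)
  have hf1 : ∀ c, f c ≤ 1 := fun c => mul_le_one' (gaussianPDF_le_one _) (gaussianPDF_le_one _)
  set x := hypDist s t with hx
  have hx0 : 0 ≤ x := abs_nonneg _
  have hxD : x = |t - s| / (1 - s * t) := by rw [hx, hypDist, abs_div, abs_of_pos hK]
  have hx2 : 1 - x ^ 2 = (1 - s * s) * (1 - t * t) / (1 - s * t) ^ 2 := by
    rw [hxD, div_pow, sq_abs, hkey, sub_div, div_self (by positivity)]
  have hx1 : x ≤ 1 := by
    have : 0 ≤ 1 - x ^ 2 := by rw [hx2]; positivity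
    nlinarith
  have hcos : √(1 - x ^ 2) = √(1 - s * s) * √(1 - t * t) / (1 - s * t) := by
    rw [hx2, Real.sqrt_div (by positivity), Real.sqrt_mul hS.le, Real.sqrt_sq hK.le]
  set gS := √(1 - s * s) with hgS
  set gT := √(1 - t * t) with hgT
  have hgS0 : 0 < gS := Real.sqrt_pos.2 hS
  have hgT0 : 0 < gT := Real.sqrt_pos.2 hT
  have hgS2 : 1 - s * s = gS ^ 2 := (Real.sq_sqrt hS.le).symm
  have hgT2 : 1 - t * t = gT ^ 2 := (Real.sq_sqrt hT.le).symm
  have hfourier : ∀ l m : ℝ, ∫ c, ((f c).toReal : ℂ) * Complex.exp ((l * (tailDeriv 2 c s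
      + slope c (s, t)) + m * (tailDeriv 2 c t + slope c (s, t)) : ℝ) * Complex.I) ∂coeffLaw
      = (((2 * Real.pi)⁻¹ * ((1 - s * t) * (gS * gT)) *
        Real.exp (-(((t - s) / ((1 - s * t) * gS ^ 3) * l) ^ 2
        + (-(t - s) / ((1 - s * t) * gT ^ 3) * m) ^ 2
        + 2 * ((t - s) / ((1 - s * t) * gS ^ 3) * (-(t - s) / ((1 - s * t) * gT ^ 3))
          * Real.cos (Real.arcsin x)) * l * m) / 2) : ℝ) : ℂ) := by
    intro l m
    obtain ⟨A, B, β, δ, ε, hA, hB, hAB, hexp⟩ := exponent_eq hS hT hK hD l m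
    have h := integral_gaussianPDFReal_mul_mul_exp (P := coeffLaw)
      (X₀ := fun c => (twoZeros c (s, t)).1) (X₁ := fun c => (twoZeros c (s, t)).2)
      (ξ := fun c => l * (tailDeriv 2 c s + slope c (s, t))
        + m * (tailDeriv 2 c t + slope c (s, t))) hmz.fst hmz.snd
      (((hmd s).add hms).const_mul l |>.add (((hmd t).add hms).const_mul m)) hA hB
      (β := β) (δ := δ) (ε := ε)
      (Q := ((t - s) ^ 2 * l ^ 2 / ((1 - s * t) ^ 2 * (1 - s * s) ^ 3)
        + (t - s) ^ 2 * m ^ 2 / ((1 - s * t) ^ 2 * (1 - t * t) ^ 3)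
        - 2 * l * m * (t - s) ^ 2 / ((1 - s * t) ^ 3 * (1 - s * s) * (1 - t * t))))
      (fun y₀ y₁ => ?_)
    · refine Eq.trans ?_ (h.trans ?_)
      · simp_rw [hf, ENNReal.toReal_mul, toReal_gaussianPDF]
      · have hAB' : √(A * B) = 1 / ((1 - s * t) * (gS * gT)) := by
          rw [hAB, hgS2, hgT2]
          rw [show 1 / (gS ^ 2 * gT ^ 2 * (1 - s * t) ^ 2) = (1 / ((1 - s * t) * (gS * gT))) ^ 2 by
            field_simp]
          exact Real.sqrt_sq (by positivity)
        rw [hAB', Real.cos_arcsin, hcos, hgS2, hgT2]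
        have hE : ((t - s) / ((1 - s * t) * gS ^ 3) * l) ^ 2
            + (-(t - s) / ((1 - s * t) * gT ^ 3) * m) ^ 2
            + 2 * ((t - s) / ((1 - s * t) * gS ^ 3) * (-(t - s) / ((1 - s * t) * gT ^ 3))
            * (gS * gT / (1 - s * t))) * l * m
            = (t - s) ^ 2 * l ^ 2 / ((1 - s * t) ^ 2 * (gS ^ 2) ^ 3)
            + (t - s) ^ 2 * m ^ 2 / ((1 - s * t) ^ 2 * (gT ^ 2) ^ 3)
            - 2 * l * m * (t - s) ^ 2 / ((1 - s * t) ^ 3 * gS ^ 2 * gT ^ 2) := by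
          clear_value gS gT
          field_simp
          ring
        rw [hE]
        congr 2
        field_simp
    · have h1 := integral_exp_tail 1 hs ht (-y₀ + (y₁ - s * y₀ + l + m) / (t - s))
        (-(y₁ - s * y₀ + l + m) / (t - s)) l m
      rw [hexp] at h1
      refine Eq.trans ?_ (h1.trans ?_)
      · refine integral_congr_ae (ae_of_all _ fun c => ?_)
        simp only
        congr 3
        simp only [twoZeros, slope]
        field_simp
        ring
      · congr 3
        rw [Finset.sum_range_succ, Finset.sum_range_one]
        simp only [pow_zero, pow_one, Nat.cast_zero, Nat.cast_one, zero_mul, mul_zero, mul_one,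
          Nat.sub_self, add_zero]
        have e1 : -y₀ + (y₁ - s * y₀ + l + m) / (t - s) + -(y₁ - s * y₀ + l + m) / (t - s) = -y₀ := by
          ring
        have e2 : (-y₀ + (y₁ - s * y₀ + l + m) / (t - s)) * s
            + -(y₁ - s * y₀ + l + m) / (t - s) * t + l + m = -y₁ := by
          field_simp
          ring
        rw [e1, e2]
        ring_nf
  have hmain := lintegral_abs_mul_of_fourier (P := coeffLaw) hfm
    (ne_of_lt (lt_of_le_of_lt (lintegral_mono hf1) (by simp)))
    (fun c => (hf1 c).trans_lt ENNReal.one_lt_top) ((hmd s).add hms) ((hmd t).add hms)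
    (by positivity) (Real.arcsin_nonneg.2 hx0)
    ((Real.arcsin_le_pi_div_two x).trans (by linarith [Real.pi_pos])) hfourier
  have hstart : ∀ c, ENNReal.ofReal |derivProd c (s, t) / (t - s)| * f c
      = ENNReal.ofReal (1 / |t - s|) * (ENNReal.ofReal |(tailDeriv 2 c s + slope c (s, t))
        * (tailDeriv 2 c t + slope c (s, t))| * f c) := by
    intro c
    have h1 : ENNReal.ofReal |derivProd c (s, t) / (t - s)| = ENNReal.ofReal (1 / |t - s|) *
        ENNReal.ofReal |(tailDeriv 2 c s + slope c (s, t)) * (tailDeriv 2 c t + slope c (s, t))| := by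
      rw [← ENNReal.ofReal_mul (by positivity), abs_div, derivProd]
      congr 1
      ring
    rw [h1, mul_assoc]
  refine (lintegral_congr hstart).trans ?_
  rw [lintegral_const_mul _ (by fun_prop)]
  refine (congrArg _ hmain).trans ?_
  rw [← ENNReal.ofReal_mul (by positivity)]
  congr 1
  rw [Real.cos_arcsin, Real.sin_arcsin (by linarith) hx1, pairCorr, Real.arccos, hcos, density,
    density, sq s, sq t, hgS2, hgT2, hxD, abs_mul, abs_div, abs_div, abs_neg,
    abs_of_pos (by positivity : 0 < (1 - s * t) * gS ^ 3),
    abs_of_pos (by positivity : 0 < (1 - s * t) * gT ^ 3)]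
  have hD' : |t - s| ≠ 0 := abs_ne_zero.2 hD
  generalize |t - s| = D at *
  generalize Real.arcsin (D / (1 - s * t)) = θ at *
  have hπ := Real.pi_ne_zero
  generalize 1 - s * t = K at *
  clear_value gS gT
  field_simp
  ring

end TwoPoint

section Monotonicity

theorem mul_cos_two_mul_lt {θ : ℝ} (h0 : 0 < θ) (h1 : θ < Real.pi / 2) :
    θ * Real.cos (2 * θ) < Real.cos θ * Real.sin θ := by
  have hsin : 2 * (Real.cos θ * Real.sin θ) = Real.sin (2 * θ) := by
    rw [Real.sin_two_mul]; ring
  have hpos : 0 < Real.sin (2 * θ) := Real.sin_pos_of_pos_of_lt_pi (by linarith) (by linarith)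
  rcases le_or_gt (Real.pi / 2) (2 * θ) with h | h
  · have hcos : Real.cos (2 * θ) ≤ 0 := Real.cos_nonpos_of_pi_div_two_le_of_le h (by linarith)
    nlinarith
  · have hcos : 0 < Real.cos (2 * θ) := Real.cos_pos_of_mem_Ioo ⟨by linarith, h⟩
    have htan := Real.lt_tan (by linarith : 0 < 2 * θ) h
    rw [Real.tan_eq_sin_div_cos, lt_div_iff₀ hcos] at htan
    linarith

theorem continuous_pairCorr : Continuous pairCorr := by
  unfold pairCorr
  have := Real.continuous_arccos
  fun_prop

theorem pairCorr_zero : pairCorr 0 = 0 := by simp [pairCorr]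

theorem pairCorr_one : pairCorr 1 = 1 := by simp [pairCorr]

theorem pairCorr_cos {θ : ℝ} (h0 : 0 ≤ θ) (h1 : θ ≤ Real.pi) :
    pairCorr (Real.cos θ) = Real.cos θ ^ 2 + Real.cos θ * Real.sin θ * θ := by
  rw [pairCorr, ← Real.sin_arccos, Real.arccos_cos h0 h1]

theorem strictMonoOn_pairCorr : StrictMonoOn pairCorr (Icc 0 1) := by
  have hanti : StrictAntiOn (fun θ => Real.cos θ ^ 2 + Real.cos θ * Real.sin θ * θ)
      (Icc 0 (Real.pi / 2)) := by
    refine strictAntiOn_of_deriv_neg (convex_Icc _ _) (by fun_prop) fun θ hθ => ?_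
    rw [interior_Icc] at hθ
    have hd : HasDerivAt (fun θ => Real.cos θ ^ 2 + Real.cos θ * Real.sin θ * θ)
        (((2 : ℕ) : ℝ) * Real.cos θ ^ (2 - 1) * -Real.sin θ
          + ((-Real.sin θ * Real.sin θ + Real.cos θ * Real.cos θ) * θ
            + Real.cos θ * Real.sin θ * 1)) θ :=
      ((Real.hasDerivAt_cos θ).pow 2).add
        (((Real.hasDerivAt_cos θ).mul (Real.hasDerivAt_sin θ)).mul (hasDerivAt_id θ))
    rw [hd.deriv]
    have h := mul_cos_two_mul_lt hθ.1 hθ.2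
    rw [Real.cos_two_mul'] at h
    norm_num
    linarith
  intro x hx y hy hxy
  have hmem : ∀ z ∈ Icc (0 : ℝ) 1, Real.arccos z ∈ Icc 0 (Real.pi / 2) := fun z hz =>
    ⟨Real.arccos_nonneg z, Real.arccos_le_pi_div_two.2 hz.1⟩
  have heq : ∀ z ∈ Icc (0 : ℝ) 1, pairCorr z = Real.cos (Real.arccos z) ^ 2
      + Real.cos (Real.arccos z) * Real.sin (Real.arccos z) * Real.arccos z := fun z hz => by
    rw [← pairCorr_cos (Real.arccos_nonneg z) (Real.arccos_le_pi z),
      Real.cos_arccos (by linarith [hz.1]) hz.2]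
  rw [heq x hx, heq y hy]
  exact hanti (hmem y hy) (hmem x hx)
    (Real.strictAntiOn_arccos ⟨by linarith [hx.1], hx.2⟩ ⟨by linarith [hy.1], hy.2⟩ hxy)

theorem one_sub_mul_pos {s t : ℝ} (hs : s ∈ Ioo (-1 : ℝ) 1) (ht : t ∈ Icc (-1 : ℝ) 1) :
    0 < 1 - s * t := by
  have h : |s * t| < 1 := by
    rw [abs_mul]
    exact mul_lt_one_of_nonneg_of_lt_one_left (abs_nonneg s) (abs_lt.2 hs) (abs_le.2 ht)
  linarith [le_abs_self (s * t)]

theorem continuousOn_hypDist {s : ℝ} (hs : s ∈ Ioo (-1 : ℝ) 1) :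
    ContinuousOn (hypDist s) (Icc (-1) 1) := by
  unfold hypDist
  exact (ContinuousOn.div (by fun_prop) (by fun_prop)
    fun t ht => (one_sub_mul_pos hs ht).ne').abs

theorem hypDist_mem_Icc {s t : ℝ} (hs : s ∈ Ioo (-1 : ℝ) 1) (ht : t ∈ Icc (-1 : ℝ) 1) :
    hypDist s t ∈ Icc (0 : ℝ) 1 := by
  have hpos := one_sub_mul_pos hs ht
  refine ⟨abs_nonneg _, ?_⟩
  obtain ⟨h1, h2⟩ := hs
  obtain ⟨h3, h4⟩ := ht
  rw [hypDist, abs_div, abs_of_pos hpos, div_le_one hpos, abs_le]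
  constructor <;> nlinarith

theorem hypDist_self (s : ℝ) : hypDist s s = 0 := by simp [hypDist]

theorem hypDist_one {s : ℝ} (hs : s ∈ Ioo (-1 : ℝ) 1) : hypDist s 1 = 1 := by
  have : 1 - s ≠ 0 := by linarith [hs.2]
  simp [hypDist, this]

theorem hypDist_neg_one {s : ℝ} (hs : s ∈ Ioo (-1 : ℝ) 1) : hypDist s (-1) = 1 := by
  have : 1 + s ≠ 0 := by linarith [hs.1]
  rw [hypDist, show -1 - s = -(1 + s) by ring, show 1 - s * -1 = 1 + s by ring, neg_div,
    div_self this]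
  norm_num

theorem div_one_sub_mul_lt {s t t' : ℝ} (hs : s ∈ Ioo (-1 : ℝ) 1) (ht : t ∈ Icc (-1 : ℝ) 1)
    (ht' : t' ∈ Icc (-1 : ℝ) 1) (h : t < t') : (t - s) / (1 - s * t) < (t' - s) / (1 - s * t') := by
  rw [div_lt_div_iff₀ (one_sub_mul_pos hs ht) (one_sub_mul_pos hs ht')]
  obtain ⟨h1, h2⟩ := hs
  nlinarith [mul_pos (sub_pos.2 h) (by nlinarith : 0 < 1 - s * s)]

theorem strictMonoOn_hypDist {s : ℝ} (hs : s ∈ Ioo (-1 : ℝ) 1) :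
    StrictMonoOn (hypDist s) (Icc s 1) := by
  intro t ht t' ht' h
  have hm : ∀ x ∈ Icc s 1, x ∈ Icc (-1 : ℝ) 1 := fun x hx => ⟨hs.1.le.trans hx.1, hx.2⟩
  have habs : ∀ x ∈ Icc s 1, hypDist s x = (x - s) / (1 - s * x) := fun x hx =>
    abs_of_nonneg (div_nonneg (sub_nonneg.2 hx.1) (one_sub_mul_pos hs (hm x hx)).le)
  rw [habs t ht, habs t' ht']
  exact div_one_sub_mul_lt hs (hm t ht) (hm t' ht') h

theorem strictAntiOn_hypDist {s : ℝ} (hs : s ∈ Ioo (-1 : ℝ) 1) :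
    StrictAntiOn (hypDist s) (Icc (-1) s) := by
  intro t ht t' ht' h
  have hm : ∀ x ∈ Icc (-1) s, x ∈ Icc (-1 : ℝ) 1 := fun x hx => ⟨hx.1, hx.2.trans hs.2.le⟩
  have habs : ∀ x ∈ Icc (-1) s, hypDist s x = -((x - s) / (1 - s * x)) := fun x hx =>
    abs_of_nonpos (div_nonpos_of_nonpos_of_nonneg (sub_nonpos.2 hx.2)
      (one_sub_mul_pos hs (hm x hx)).le)
  rw [habs t ht, habs t' ht']
  exact neg_lt_neg (div_one_sub_mul_lt hs (hm t ht) (hm t' ht') h)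

theorem density_pos {t : ℝ} (ht : t ∈ Ioo (-1 : ℝ) 1) : 0 < density t := by
  have : 0 < 1 - t ^ 2 := by
    rw [sq]
    exact one_sub_mul_pos ht (Ioo_subset_Icc_self ht)
  unfold density
  positivity

theorem continuousOn_density : ContinuousOn density (Ioo (-1) 1) := by
  unfold density
  refine ContinuousOn.div (by fun_prop) (by fun_prop) fun t ht => ?_
  rw [sq]
  exact (mul_pos Real.pi_pos (one_sub_mul_pos ht (Ioo_subset_Icc_self ht))).ne'

theorem pairCorr_hypDist_mem_Icc {s t : ℝ} (hs : s ∈ Ioo (-1 : ℝ) 1) (ht : t ∈ Icc (-1 : ℝ) 1) :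
    pairCorr (hypDist s t) ∈ Icc (0 : ℝ) 1 := by
  have h := hypDist_mem_Icc hs ht
  have hm := strictMonoOn_pairCorr.monotoneOn
  constructor
  · rw [← pairCorr_zero]
    exact hm (left_mem_Icc.2 zero_le_one) h h.1
  · rw [← pairCorr_one]
    exact hm h (right_mem_Icc.2 zero_le_one) h.2

end Monotonicity

section Uniqueness

variable {Ω : Type*} [MeasurableSpace Ω] {P : Measure Ω} {Z : Ω → Set ℝ}

/-- Off the diagonals, correlation functions are determined by the counts. -/
theorem IsCorrelationFunction.le_of_injective {n : ℕ} {ρ ρ' : (Fin n → ℝ) → ℝ}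
    (h : IsCorrelationFunction P Z n ρ) (h' : IsCorrelationFunction P Z n ρ') {t : Fin n → ℝ}
    (ht : t ∈ Set.pi univ fun _ => Ioo (-1 : ℝ) 1) (hinj : Injective t) : ρ' t ≤ ρ t := by
  by_contra! hlt
  obtain ⟨m₁, hm₁, hm₁'⟩ := exists_between hlt
  obtain ⟨m₂, hm₂, hm₂'⟩ := exists_between hm₁'
  have hopen : IsOpen (Set.pi univ fun _ : Fin n => Ioo (-1 : ℝ) 1) :=
    isOpen_set_pi finite_univ fun _ _ => isOpen_Ioo
  have hnhds := hopen.mem_nhds ht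
  have e1 : ∀ᶠ z in 𝓝 t, ρ z < m₁ := (h.continuousOn.continuousAt hnhds).eventually_lt_const hm₁
  have e2 : ∀ᶠ z in 𝓝 t, m₂ < ρ' z := (h'.continuousOn.continuousAt hnhds).eventually_const_lt hm₂'
  have e3 : ∀ᶠ z in 𝓝 t, ∀ i j, i ≠ j → z i ≠ z j := by
    simp only [eventually_all]
    intro i j hij
    exact ((continuous_apply i).continuousAt.ne_iff_eventually_ne
      (continuous_apply j).continuousAt).1 (hinj.ne hij)
  obtain ⟨δ, hδ, hball⟩ := Metric.eventually_nhds_iff_ball.1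
    ((e1.and e2).and (e3.and (hopen.eventually_mem ht)))
  have hpi : Metric.ball t δ = Set.pi univ fun i => Metric.ball (t i) δ := ball_pi t hδ
  have hmem : ∀ i j, ∀ x ∈ Metric.ball (t i) δ, x ∈ Metric.ball (t j) δ →
      (fun k => if k = i ∨ k = j then x else t k) ∈ Metric.ball t δ := by
    intro i j x hi hj
    rw [hpi]
    intro k _
    by_cases hk : k = i ∨ k = j
    · simp only [hk, if_true]
      rcases hk with rfl | rfl
      exacts [hi, hj]
    · simp only [hk, if_false]
      exact Metric.mem_ball_self hδ
  have hsub : ∀ i, Metric.ball (t i) δ ⊆ Ioo (-1 : ℝ) 1 := fun i x hx => by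
    have := (hball _ (hmem i i x hx hx)).2.2 i (mem_univ i)
    simpa using this
  have hdisj : ∀ i j, i ≠ j → Disjoint (Metric.ball (t i) δ) (Metric.ball (t j) δ) :=
    fun i j hij => Set.disjoint_left.2 fun x hi hj =>
      (hball _ (hmem i j x hi hj)).2.1 i j hij (by simp)
  have hD : ∀ i, MeasurableSet (Metric.ball (t i) δ) := fun i => measurableSet_ball
  have heq := (h.lintegral_prod_count _ hD hsub hdisj).symm.trans
    (h'.lintegral_prod_count _ hD hsub hdisj)
  rw [← hpi] at heq
  have hvol : volume (Metric.ball t δ) ≠ 0 := (Metric.measure_ball_pos volume t hδ).ne'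
  have hm₁0 : 0 ≤ m₁ := (h.nonneg t ht).trans hm₁.le
  have hle : ∫⁻ z in Metric.ball t δ, ENNReal.ofReal (ρ z)
      ≤ ENNReal.ofReal m₁ * volume (Metric.ball t δ) := by
    rw [← setLIntegral_const]
    exact setLIntegral_mono measurable_const fun z hz =>
      ENNReal.ofReal_le_ofReal (hball z hz).1.1.le
  have hge : ENNReal.ofReal m₂ * volume (Metric.ball t δ)
      ≤ ∫⁻ z in Metric.ball t δ, ENNReal.ofReal (ρ' z) := by
    rw [← setLIntegral_const]
    exact setLIntegral_mono' measurableSet_ball fun z hz =>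
      ENNReal.ofReal_le_ofReal (hball z hz).1.2.le
  have hlt' : ENNReal.ofReal m₁ * volume (Metric.ball t δ)
      < ENNReal.ofReal m₂ * volume (Metric.ball t δ) :=
    ENNReal.mul_lt_mul_left hvol Metric.isBounded_ball.measure_lt_top.ne
      ((ENNReal.ofReal_lt_ofReal_iff (hm₁0.trans_lt hm₂)).2 hm₂)
  exact absurd heq (hle.trans_lt (hlt'.trans_le hge)).ne

theorem IsCorrelationFunction.eq_of_injective {n : ℕ} {ρ ρ' : (Fin n → ℝ) → ℝ}
    (h : IsCorrelationFunction P Z n ρ) (h' : IsCorrelationFunction P Z n ρ') {t : Fin n → ℝ}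
    (ht : t ∈ Set.pi univ fun _ => Ioo (-1 : ℝ) 1) (hinj : Injective t) : ρ t = ρ' t :=
  (h'.le_of_injective h ht hinj).antisymm (h.le_of_injective h' ht hinj)

theorem IsCorrelationFunction.eq_one {ρ ρ' : (Fin 1 → ℝ) → ℝ}
    (h : IsCorrelationFunction P Z 1 ρ) (h' : IsCorrelationFunction P Z 1 ρ') {s : ℝ}
    (hs : s ∈ Ioo (-1 : ℝ) 1) : ρ ![s] = ρ' ![s] :=
  h.eq_of_injective h' (fun i _ => by simpa using hs) (injective_of_subsingleton _)

theorem IsCorrelationFunction.eq_two {ρ ρ' : (Fin 2 → ℝ) → ℝ}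
    (h : IsCorrelationFunction P Z 2 ρ) (h' : IsCorrelationFunction P Z 2 ρ') {s t : ℝ}
    (hs : s ∈ Ioo (-1 : ℝ) 1) (ht : t ∈ Ioo (-1 : ℝ) 1) : ρ ![s, t] = ρ' ![s, t] := by
  have hmem : ∀ u ∈ Ioo (-1 : ℝ) 1, ![s, u] ∈ Set.pi univ fun _ : Fin 2 => Ioo (-1 : ℝ) 1 := by
    intro u hu i _
    fin_cases i
    exacts [hs, hu]
  have hne : ∀ u ∈ Ioo (-1 : ℝ) 1, u ≠ s → ρ ![s, u] = ρ' ![s, u] := by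
    intro u hu hus
    refine h.eq_of_injective h' (hmem u hu) fun i j hij => ?_
    fin_cases i <;> fin_cases j <;> simp_all
  by_cases hst : t = s
  · subst hst
    have hcont : ∀ {σ : (Fin 2 → ℝ) → ℝ}, IsCorrelationFunction P Z 2 σ →
        Tendsto (fun u => σ ![t, u]) (𝓝[≠] t) (𝓝 (σ ![t, t])) := by
      intro σ hσ
      have h1 : ContinuousOn (fun u => σ ![t, u]) (Ioo (-1) 1) :=
        hσ.continuousOn.comp (by fun_prop) hmem
      exact (h1.continuousAt (Ioo_mem_nhds ht.1 ht.2)).tendsto.mono_left nhdsWithin_le_nhds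
    refine tendsto_nhds_unique (hcont h) ((hcont h').congr' ?_)
    filter_upwards [self_mem_nhdsWithin, nhdsWithin_le_nhds (Ioo_mem_nhds ht.1 ht.2)] with u h1 h2
    exact (hne u h2 h1).symm
  · exact hne t ht hst

end Uniqueness

section Existence

variable {Ω : Type*} [MeasurableSpace Ω] {P : Measure Ω} {a : ℕ → Ω → ℝ}

theorem IsIIDStandardGaussian.hasLaw_coeffLaw (ha : IsIIDStandardGaussian P a) :
    HasLaw (fun ω k => a k ω) coeffLaw P :=
  ha.indep.hasLaw_infinitePi ha.hasLaw (aemeasurable_pi_iff.2 fun k => (ha.hasLaw k).aemeasurable)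

theorem IsIIDStandardGaussian.lintegral_comp (ha : IsIIDStandardGaussian P a)
    {g : (ℕ → ℝ) → ℝ≥0∞} (hg : AEMeasurable g coeffLaw) :
    ∫⁻ ω, g (fun k => a k ω) ∂P = ∫⁻ c, g c ∂coeffLaw := by
  have h := ha.hasLaw_coeffLaw
  rw [← h.map_eq] at hg ⊢
  exact (lintegral_map' hg h.aemeasurable).symm

theorem isCorrelationFunction_one (ha : IsIIDStandardGaussian P a) :
    IsCorrelationFunction P (realZeros a) 1 fun t => density (t 0) where
  continuousOn := continuousOn_density.comp (by fun_prop) fun t ht => ht 0 (mem_univ 0)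
  nonneg t ht := (density_pos (ht 0 (mem_univ 0))).le
  lintegral_prod_count D hD hDI _ := by
    simp only [Fin.prod_univ_one]
    have h1 := ha.lintegral_comp (aemeasurable_encard_zeroSet (hD 0))
    refine h1.trans ((lintegral_encard_zeroSet (hD 0) (hDI 0)).trans ?_)
    have hset : Set.pi univ D = MeasurableEquiv.funUnique (Fin 1) ℝ ⁻¹' D 0 := by
      ext t
      simp [Set.mem_pi, MeasurableEquiv.funUnique]
    rw [hset]
    refine (setLIntegral_congr_fun (hD 0) fun t ht =>
      lintegral_one_point (abs_lt.2 (hDI 0 ht))).trans ?_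
    exact ((volume_preserving_funUnique (Fin 1) ℝ).setLIntegral_comp_preimage_emb
      (MeasurableEquiv.measurableEmbedding _) (fun x => ENNReal.ofReal (density x)) _).symm

theorem isCorrelationFunction_two (ha : IsIIDStandardGaussian P a) :
    IsCorrelationFunction P (realZeros a) 2 fun t =>
      density (t 0) * density (t 1) * pairCorr (hypDist (t 0) (t 1)) where
  continuousOn := by
    have hd : ∀ i : Fin 2, ContinuousOn (fun t : Fin 2 → ℝ => density (t i))
        (Set.pi univ fun _ => Ioo (-1 : ℝ) 1) := fun i =>
      continuousOn_density.comp (by fun_prop) fun t ht => ht i (mem_univ i)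
    have hr : ContinuousOn (fun t : Fin 2 → ℝ => (t 1 - t 0) / (1 - t 0 * t 1))
        (Set.pi univ fun _ => Ioo (-1 : ℝ) 1) :=
      ContinuousOn.div (by fun_prop) (by fun_prop) fun t ht =>
        (one_sub_mul_pos (ht 0 (mem_univ 0)) (Ioo_subset_Icc_self (ht 1 (mem_univ 1)))).ne'
    exact ((hd 0).mul (hd 1)).mul (continuous_pairCorr.comp_continuousOn hr.abs)
  nonneg t ht := mul_nonneg
    (mul_nonneg (density_pos (ht 0 (mem_univ 0))).le (density_pos (ht 1 (mem_univ 1))).le)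
    (pairCorr_hypDist_mem_Icc (ht 0 (mem_univ 0)) (Ioo_subset_Icc_self (ht 1 (mem_univ 1)))).1
  lintegral_prod_count D hD hDI hdisj := by
    simp only [Fin.prod_univ_two]
    have hd := hdisj 0 1 (by decide)
    have h1 := ha.lintegral_comp ((aemeasurable_encard_zeroSet (hD 0)).mul
      (aemeasurable_encard_zeroSet (hD 1)))
    refine h1.trans ((lintegral_encard_zeroSet_mul (hD 0) (hD 1) (hDI 0) (hDI 1) hd).trans ?_)
    have hset : Set.pi univ D = MeasurableEquiv.finTwoArrow ⁻¹' D 0 ×ˢ D 1 := by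
      ext t
      simp [Set.mem_pi, MeasurableEquiv.finTwoArrow, Fin.forall_fin_two]
    rw [hset]
    refine (setLIntegral_congr_fun ((hD 0).prod (hD 1)) fun z hz =>
      lintegral_two_point (abs_lt.2 (hDI 0 hz.1)) (abs_lt.2 (hDI 1 hz.2))
        (hd.ne_of_mem hz.1 hz.2)).trans ?_
    exact ((volume_preserving_finTwoArrow ℝ).setLIntegral_comp_preimage_emb
      (MeasurableEquiv.measurableEmbedding _)
      (fun z => ENNReal.ofReal (density z.1 * density z.2 * pairCorr (hypDist z.1 z.2))) _).symm

end Existence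

end GaussianPowerSeries

theorem mainTheorem5 {Ω : Type*} [MeasurableSpace Ω] (P : Measure Ω) [IsProbabilityMeasure P]
    (a : ℕ → Ω → ℝ) (ha : GaussianPowerSeries.IsIIDStandardGaussian P a) :
    (∃ ρ₁ : (Fin 1 → ℝ) → ℝ, GaussianPowerSeries.IsCorrelationFunction P
      (GaussianPowerSeries.realZeros a) 1 ρ₁) ∧
    (∃ ρ₂ : (Fin 2 → ℝ) → ℝ, GaussianPowerSeries.IsCorrelationFunction P
      (GaussianPowerSeries.realZeros a) 2 ρ₂) ∧
    ∀ (ρ₁ : (Fin 1 → ℝ) → ℝ) (ρ₂ : (Fin 2 → ℝ) → ℝ),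
      GaussianPowerSeries.IsCorrelationFunction P (GaussianPowerSeries.realZeros a) 1 ρ₁ →
      GaussianPowerSeries.IsCorrelationFunction P (GaussianPowerSeries.realZeros a) 2 ρ₂ →
      (∀ s ∈ Ioo (-1 : ℝ) 1, 0 < ρ₁ ![s]) ∧
      (∀ s ∈ Ioo (-1 : ℝ) 1, ∃ R : ℝ → ℝ,
        ContinuousOn R (Icc (-1 : ℝ) 1) ∧
        (∀ t ∈ Ioo (-1 : ℝ) 1, R t = GaussianPowerSeries.normalizedCorrelation ρ₁ ρ₂ s t) ∧
        R s = 0 ∧ R 1 = 1 ∧ R (-1) = 1 ∧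
        StrictMonoOn R (Icc s 1) ∧ StrictAntiOn R (Icc (-1 : ℝ) s)) ∧
      (∀ s ∈ Ioo (-1 : ℝ) 1, ∀ t ∈ Ioo (-1 : ℝ) 1, ρ₂ ![s, t] ≤ ρ₁ ![s] * ρ₁ ![t]) := by
  open GaussianPowerSeries in
  have hone := isCorrelationFunction_one ha
  have htwo := isCorrelationFunction_two ha
  refine ⟨⟨_, hone⟩, ⟨_, htwo⟩, fun ρ₁ ρ₂ h₁ h₂ => ?_⟩
  have hρ₁ : ∀ s ∈ Ioo (-1 : ℝ) 1, ρ₁ ![s] = density s := fun s hs => h₁.eq_one hone hs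
  have hρ₂ : ∀ s ∈ Ioo (-1 : ℝ) 1, ∀ t ∈ Ioo (-1 : ℝ) 1,
      ρ₂ ![s, t] = density s * density t * pairCorr (hypDist s t) :=
    fun s hs t ht => h₂.eq_two htwo hs ht
  refine ⟨fun s hs => hρ₁ s hs ▸ density_pos hs, fun s hs => ?_, fun s hs t ht => ?_⟩
  · refine ⟨fun t => pairCorr (hypDist s t),
      continuous_pairCorr.comp_continuousOn (continuousOn_hypDist hs), fun t ht => ?_,
      by simp only [hypDist_self, pairCorr_zero], by simp only [hypDist_one hs, pairCorr_one],
      by simp only [hypDist_neg_one hs, pairCorr_one], ?_, ?_⟩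
    · have hds := (density_pos hs).ne'
      have hdt := (density_pos ht).ne'
      rw [normalizedCorrelation, hρ₁ s hs, hρ₁ t ht, hρ₂ s hs t ht]
      field_simp
    · exact strictMonoOn_pairCorr.comp (strictMonoOn_hypDist hs) fun t ht =>
        hypDist_mem_Icc hs ⟨hs.1.le.trans ht.1, ht.2⟩
    · exact strictMonoOn_pairCorr.comp_strictAntiOn (strictAntiOn_hypDist hs) fun t ht =>
        hypDist_mem_Icc hs ⟨ht.1, ht.2.trans hs.2.le⟩
  · rw [hρ₁ s hs, hρ₁ t ht, hρ₂ s hs t ht]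
    exact mul_le_of_le_one_right (mul_pos (density_pos hs) (density_pos ht)).le
      (pairCorr_hypDist_mem_Icc hs (Ioo_subset_Icc_self ht)).2
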